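/- Let $G$ be a Lie group and $\pi: P\to M$ a smooth (right) principal $G$-bundle over a manifold $M$ (manifolds are finite-dimensional, Hausdorff, without boundary). Let $\mathcal{G}(P)=(P\times P)/G\rightrightarrows M$ be its gauge groupoid, the orbit space of the diagonal action, with quotient map $q:P\times P\to\mathcal{G}(P)$, $q(p_1,p_2)=\overline{(p_1,p_2)}$, target $\overline{(p_1,p_2)}\mapsto\pi(p_1)$, source $\overline{(p_1,p_2)}\mapsto \pi(p_2)$ and multiplication $\overline{(p_1,p_2)}\cdot\overline{(p_2,p_3)}=\overline{(p_1,p_3)}$. For $(X,Y)\in TP\times TP$ write $\overline{(X,Y)}=Tq(X,Y)\in T\mathcal{G}(P)$. Let $\theta\in\Omega^1(P,\mathfrak{g})$ be a principal connection, with associated vertical projection $\Theta(X)=(\theta(X))_P$, where $u_P$ denotes the infinitesimal generator of the action given by $u\in\mathfrak g$. Let $K\in\Omega^1(\mathcal{G}(P),T\mathcal{G}(P))$ be the corresponding projection, i.e. $K(\overline{(X,Y)})=\overline{(\Theta(X),\Theta(Y))}$ for all $X,Y\in TP$. Then there is exactly one vector-valued $2$-form $R_K\in\Omega^2(\mathcal{G}(P),T\mathcal{G}(P))$,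 the curvature of $K$, such that $$R_K(X,Y)=K\big([(\mathrm{Id}-K)(X),(\mathrm{Id}-K)(Y)]\big)\quad\text{for all vector fields } X,Y \text{ on } \mathcal{G}(P),$$ and $R_K$ is multiplicative. Here a vector-valued $k$-form $R$ on (the space of arrows of) a Lie groupoid $\mathcal{G}\rightrightarrows M$ is called multiplicative if there is a vector-valued $k$-form $R_M\in\Omega^k(M,TM)$ such that $(R,R_M)$ is a groupoid morphism from $\oplus^kT\mathcal{G}\rightrightarrows\oplus^kTM$ to the tangent groupoid $T\mathcal{G}\rightrightarrows TM$, whose structure maps are the derivatives of those of $\mathcal{G}$. -/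

import Mathlib

open Set Function Bundle Topology
open scoped Manifold ContDiff

noncomputable section

/-! ### Vector-valued forms and their curvature -/

section Forms

variable {E H : Type*} [NormedAddCommGroup E] [NormedSpace ℝ E] [TopologicalSpace H]
  (I : ModelWithCorners ℝ E H) (N : Type*) [TopologicalSpace N] [ChartedSpace H N]

/-- `X` is a smooth vector field on the set `U`. -/
def SmoothFieldOn [IsManifold I ∞ N] (X : ∀ x : N, TangentSpace I x) (U : Set N) : Prop :=
  ContMDiffOn I I.tangent ∞ (fun x => (⟨x, X x⟩ : TangentBundle I N)) U

/-- A vector-valued `k`-form on `N`, that is, a smooth section of `⋀ᵏ T*N ⊗ TN`.  Smoothness means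
that the form sends smooth vector fields on an open set to a smooth vector field on that set. -/
structure VectorForm [IsManifold I ∞ N] (k : ℕ) where
  toFun : ∀ x : N, (TangentSpace I x) [⋀^Fin k]→L[ℝ] (TangentSpace I x)
  smooth' : ∀ U : Set N, IsOpen U → ∀ X : Fin k → ∀ x : N, TangentSpace I x,
    (∀ i, SmoothFieldOn I N (X i) U) → SmoothFieldOn I N (fun x => toFun x fun i => X i x) U

variable {I N}

instance [IsManifold I ∞ N] (k : ℕ) : CoeFun (VectorForm I N k)
    (fun _ => ∀ x : N, (TangentSpace I x) [⋀^Fin k]→L[ℝ] (TangentSpace I x)) :=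
  ⟨VectorForm.toFun⟩

/-- `R` is the curvature of the projection `K : TN → TN`:
`R(X, Y) = K([(Id - K) X, (Id - K) Y])` for all smooth vector fields `X`, `Y` on `N`. -/
def IsCurvature [IsManifold I ∞ N] (K : VectorForm I N 1) (R : VectorForm I N 2) : Prop :=
  ∀ X Y : ∀ x : N, TangentSpace I x, SmoothFieldOn I N X univ → SmoothFieldOn I N Y univ →
    ∀ x : N, R x ![X x, Y x] =
      K x fun _ => VectorField.mlieBracket I
        (fun y => X y - K y fun _ => X y) (fun y => Y y - K y fun _ => Y y) x

end Forms

/-! ### Lie groupoids and multiplicative vector-valued forms -/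

/-- A groupoid with space of arrows `A` and space of objects `M`;
`mul g h` is the product of the composable pair `(g, h)`, for which `src g = tgt h`. -/
structure GroupoidOver (A M : Type*) where
  src : A → M
  tgt : A → M
  unit : M → A
  inv : A → A
  mul : ∀ g h : A, src g = tgt h → A
  src_unit : ∀ x, src (unit x) = x
  tgt_unit : ∀ x, tgt (unit x) = x
  src_inv : ∀ g, src (inv g) = tgt g
  tgt_inv : ∀ g, tgt (inv g) = src g
  src_mul : ∀ g h c, src (mul g h c) = src h
  tgt_mul : ∀ g h c, tgt (mul g h c) = tgt g
  mul_assoc : ∀ (g h k : A) (c : src g = tgt h) (d : src h = tgt k),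
    mul (mul g h c) k ((src_mul g h c).trans d) = mul g (mul h k d) (c.trans (tgt_mul h k d).symm)
  unit_mul : ∀ g, mul (unit (tgt g)) g (src_unit _) = g
  mul_unit : ∀ g, mul g (unit (src g)) (tgt_unit _).symm = g
  inv_mul : ∀ g, mul (inv g) g (src_inv g) = unit (src g)
  mul_inv : ∀ g, mul g (inv g) (tgt_inv g).symm = unit (tgt g)

namespace GroupoidOver

variable {A M : Type*} (𝒢 : GroupoidOver A M)

/-- The set of composable arrows, as a subset of `A × A`. -/
def composable : Set (A × A) := {x | 𝒢.src x.1 = 𝒢.tgt x.2}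

open Classical in
/-- The multiplication, extended arbitrarily to all pairs of arrows. -/
def mulExt (x : A × A) : A := if c : 𝒢.src x.1 = 𝒢.tgt x.2 then 𝒢.mul x.1 x.2 c else x.1

end GroupoidOver

section LieGroupoids

variable {EA HA EM HM : Type*}
  [NormedAddCommGroup EA] [NormedSpace ℝ EA] [TopologicalSpace HA]
  [NormedAddCommGroup EM] [NormedSpace ℝ EM] [TopologicalSpace HM]
  (IA : ModelWithCorners ℝ EA HA) (IM : ModelWithCorners ℝ EM HM)
  (A M : Type*) [TopologicalSpace A] [ChartedSpace HA A] [TopologicalSpace M] [ChartedSpace HM M]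

/-- A Lie groupoid: a groupoid with smooth structure maps, whose source and target are submersions.
The composable arrows form an embedded submanifold of `A × A`, and smoothness of the multiplication
is smoothness along this subset. -/
structure LieGroupoid extends GroupoidOver A M where
  contMDiff_src : ContMDiff IA IM ∞ src
  contMDiff_tgt : ContMDiff IA IM ∞ tgt
  submersion_src : ∀ g, Surjective (mfderiv IA IM src g)
  submersion_tgt : ∀ g, Surjective (mfderiv IA IM tgt g)
  contMDiff_unit : ContMDiff IM IA ∞ unit
  contMDiff_inv : ContMDiff IA IA ∞ inv
  contMDiffOn_mul : ContMDiffOn (IA.prod IA) IA ∞ toGroupoidOver.mulExt toGroupoidOver.composable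

variable {IA IM A M}

namespace LieGroupoid

variable (𝒢 : LieGroupoid IA IM A M)

/-- The tangent multiplication `Tm` at a composable pair `(g, h)`.  Only its values at pairs `(X, Y)`
with `Ts(X) = Tt(Y)`, i.e. at the vectors tangent to the submanifold of composable arrows, are
meaningful: on these the derivative of `m` along this submanifold is uniquely determined. -/
def tangentMul (g h : A) (X : TangentSpace IA g) (Y : TangentSpace IA h) :
    TangentSpace IA (𝒢.mulExt (g, h)) :=
  mfderivWithin (IA.prod IA) IA 𝒢.mulExt 𝒢.composable (g, h) (X, Y)

/-- `X` and `Y` are composable arrows of the tangent groupoid: `Ts(X) = Tt(Y)` in `TM`. -/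
def TangentComposable (g h : A) (X : TangentSpace IA g) (Y : TangentSpace IA h) : Prop :=
  tangentMap IA IM 𝒢.src (⟨g, X⟩ : TangentBundle IA A) =
    tangentMap IA IM 𝒢.tgt (⟨h, Y⟩ : TangentBundle IA A)

/-- The form `K` is multiplicative: for some form `K_M` on the base, `(K, K_M)` is a morphism from
the groupoid `⊕ᵏ TA ⇉ ⊕ᵏ TM` to the groupoid `TA ⇉ TM`. -/
def IsMultiplicative [IsManifold IA ∞ A] [IsManifold IM ∞ M] {k : ℕ} (K : VectorForm IA A k) :
    Prop :=
  ∃ KM : VectorForm IM M k,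
    (∀ (g : A) (X : Fin k → TangentSpace IA g),
      mfderiv IA IM 𝒢.src g (K g X) = KM (𝒢.src g) fun i => mfderiv IA IM 𝒢.src g (X i)) ∧
    (∀ (g : A) (X : Fin k → TangentSpace IA g),
      mfderiv IA IM 𝒢.tgt g (K g X) = KM (𝒢.tgt g) fun i => mfderiv IA IM 𝒢.tgt g (X i)) ∧
    ∀ (g h : A) (X : Fin k → TangentSpace IA g) (Y : Fin k → TangentSpace IA h),
      𝒢.src g = 𝒢.tgt h → (∀ i, 𝒢.TangentComposable g h (X i) (Y i)) →
      K (𝒢.mulExt (g, h)) (fun i => 𝒢.tangentMul g h (X i) (Y i)) =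
        𝒢.tangentMul g h (K g X) (K h Y)

end LieGroupoid

end LieGroupoids

/-! ### Principal bundles and principal connections -/

section Principal

variable {EM HM EG HG EP HP : Type*}
  [NormedAddCommGroup EM] [NormedSpace ℝ EM] [TopologicalSpace HM]
  [NormedAddCommGroup EG] [NormedSpace ℝ EG] [TopologicalSpace HG]
  [NormedAddCommGroup EP] [NormedSpace ℝ EP] [TopologicalSpace HP]
  (IM : ModelWithCorners ℝ EM HM) (IG : ModelWithCorners ℝ EG HG) (IP : ModelWithCorners ℝ EP HP)
  (M G P : Type*)
  [TopologicalSpace M] [ChartedSpace HM M] [TopologicalSpace P] [ChartedSpace HP P]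
  [TopologicalSpace G] [ChartedSpace HG G] [Group G] [MulAction Gᵐᵒᵖ P]

variable {M G P} in
/-- A local trivialization `P|_U ≃ U × G` is principal if it is a diffeomorphism which
intertwines the right action of `G` on `P` with right multiplication in `G`. -/
structure IsPrincipalTrivialization {pr : P → M} (e : Trivialization G pr) : Prop where
  contMDiffOn : ContMDiffOn IP (IM.prod IG) ∞ e e.source
  contMDiffOn_symm : ContMDiffOn (IM.prod IG) IP ∞ e.toOpenPartialHomeomorph.symm e.target
  map_act : ∀ p ∈ e.source, ∀ g : G, (e (MulOpposite.op g • p)).2 = (e p).2 * g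

/-- A (right) principal `G`-bundle `P → M`; the right action is `(p, g) ↦ MulOpposite.op g • p`. -/
structure PrincipalBundle where
  proj : P → M
  contMDiff_act : ContMDiff (IP.prod IG) IP ∞ fun x : P × G => MulOpposite.op x.2 • x.1
  proj_act : ∀ (p : P) (g : G), proj (MulOpposite.op g • p) = proj p
  exists_trivialization : ∀ x : M, ∃ e : Trivialization G proj,
    x ∈ e.baseSet ∧ IsPrincipalTrivialization IM IG IP e

variable {IM IG IP M G P}

namespace PrincipalBundle

/-- The infinitesimal generator `u_P` of the action, at the point `p`, for `u` in the Lie algebra. -/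
def generator (_B : PrincipalBundle IM IG IP M G P) (u : GroupLieAlgebra IG G) (p : P) :
    TangentSpace IP p :=
  (mfderiv IG IP (fun g : G => MulOpposite.op g • p) 1 u : EP)

/-- A principal connection: a smooth one-form `θ` on `P` with values in the Lie algebra of `G`
such that `θ(u_P) = u` and `ψ_g^* θ = Ad_{g⁻¹} θ`. -/
structure Connection [IsManifold IP ∞ P] (B : PrincipalBundle IM IG IP M G P) where
  toFun : ∀ p : P, TangentSpace IP p →L[ℝ] GroupLieAlgebra IG G
  smooth' : ∀ U : Set P, IsOpen U → ∀ X : ∀ p : P, TangentSpace IP p, SmoothFieldOn IP P X U →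
    ContMDiffOn (M' := EG) IP 𝓘(ℝ, EG) ∞ (fun p => toFun p (X p)) U
  map_generator : ∀ (u : GroupLieAlgebra IG G) (p : P), toFun p (B.generator u p) = u
  map_act : ∀ (g : G) (p : P) (X : TangentSpace IP p),
    (toFun (MulOpposite.op g • p) (mfderiv IP IP (fun q : P => MulOpposite.op g • q) p X) : EG) =
      (mfderiv IG IG (fun h : G => g⁻¹ * h * g) 1 (toFun p X) : EG)


/-! ### The gauge groupoid -/

section Basic

variable (B : PrincipalBundle IM IG IP M G P)

theorem eq_of_trivialization {e : Trivialization G B.proj} {p q : P} (h : B.proj p = B.proj q)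
    (hp : B.proj p ∈ e.baseSet) (h' : (e p).2 = (e q).2) : p = q :=
  e.injOn (e.mem_source.2 hp) (e.mem_source.2 (h ▸ hp))
    (Prod.ext ((e.coe_fst' hp).trans (h.trans (e.coe_fst' (h ▸ hp)).symm)) h')

theorem exists_act_eq {p q : P} (h : B.proj p = B.proj q) :
    ∃ g : G, q = MulOpposite.op g • p := by
  obtain ⟨e, hx, he⟩ := B.exists_trivialization (B.proj p)
  have hp : p ∈ e.source := e.mem_source.2 hx
  refine ⟨(e p).2⁻¹ * (e q).2, (B.eq_of_trivialization (e := e) ?_ ?_ ?_).symm⟩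
  · rw [B.proj_act, h]
  · rwa [B.proj_act]
  · rw [he.map_act p hp]; group

theorem act_injective (B : PrincipalBundle IM IG IP M G P) (p : P) : Injective fun g : G => MulOpposite.op g • p := by
  intro g h hgh
  obtain ⟨e, hx, he⟩ := B.exists_trivialization (B.proj p)
  have hp : p ∈ e.source := e.mem_source.2 hx
  have := congrArg (fun q => (e q).2) hgh
  simpa [he.map_act p hp] using this

theorem contMDiff_proj : ContMDiff IP IM ∞ B.proj := by
  intro p
  obtain ⟨e, hx, he⟩ := B.exists_trivialization (B.proj p)
  have hp : p ∈ e.source := e.mem_source.2 hx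
  have h := contMDiffAt_fst.comp p ((he.contMDiffOn p hp).contMDiffAt (e.open_source.mem_nhds hp))
  exact h.congr_of_eventuallyEq
    (Filter.eventuallyEq_of_mem (e.open_source.mem_nhds hp) fun q hq => (e.coe_fst hq).symm)

theorem surjective_mfderiv_proj (p : P) : Surjective (mfderiv IP IM B.proj p) := by
  obtain ⟨e, hx, he⟩ := B.exists_trivialization (B.proj p)
  have hp : p ∈ e.source := e.mem_source.2 hx
  have ht : (B.proj p, (e p).2) ∈ e.target := e.mem_target.2 hx
  set f : M → P := fun x => e.toOpenPartialHomeomorph.symm (x, (e p).2) with hf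
  have hfp : f (B.proj p) = p := e.symm_apply_mk_proj hp
  have h1 : ContMDiffAt IM IP ∞ f (B.proj p) :=
    ContMDiffAt.comp (B.proj p) (g := e.toOpenPartialHomeomorph.symm) (f := fun x => (x, (e p).2))
      ((he.contMDiffOn_symm _ ht).contMDiffAt (e.open_target.mem_nhds ht))
      (contMDiffAt_id.prodMk contMDiffAt_const)
  have h2 : B.proj ∘ f =ᶠ[𝓝 (B.proj p)] id :=
    Filter.eventuallyEq_of_mem (e.open_baseSet.mem_nhds hx) fun x hx' => e.proj_symm_apply' hx'
  have h3 : HasMFDerivAt IM IM (B.proj ∘ f) (B.proj p)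
      ((mfderiv IP IM B.proj (f (B.proj p))).comp (mfderiv IM IP f (B.proj p))) :=
    HasMFDerivAt.comp _ ((B.contMDiff_proj _).mdifferentiableAt (by simp)).hasMFDerivAt
      (h1.mdifferentiableAt (by simp)).hasMFDerivAt
  have h4 := hasMFDerivAt_unique h3 ((hasMFDerivAt_id (B.proj p)).congr_of_eventuallyEq h2)
  intro v
  rw [← hfp]
  refine ⟨mfderiv IM IP f (B.proj p) v, ?_⟩
  exact DFunLike.congr_fun h4 v

end Basic

/-- The space of arrows `(P × P) / G` of the gauge groupoid, with the quotient topology. -/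
def GaugeSpace (_B : PrincipalBundle IM IG IP M G P) : Type _ :=
  MulAction.orbitRel.Quotient Gᵐᵒᵖ (P × P)

variable (B : PrincipalBundle IM IG IP M G P)

instance : TopologicalSpace B.GaugeSpace :=
  inferInstanceAs (TopologicalSpace (Quotient (MulAction.orbitRel Gᵐᵒᵖ (P × P))))

/-- The class of `(p, q)` in `(P × P) / G`. -/
def arrow (z : P × P) : B.GaugeSpace := Quotient.mk (MulAction.orbitRel Gᵐᵒᵖ (P × P)) z

theorem arrow_surjective : Surjective B.arrow := Quotient.mk_surjective

theorem arrow_eq_arrow {z w : P × P} :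
    B.arrow z = B.arrow w ↔ ∃ g : G, z = (MulOpposite.op g • w.1, MulOpposite.op g • w.2) := by
  refine Quotient.eq.trans ⟨?_, ?_⟩
  · rintro ⟨g, rfl⟩
    exact ⟨g.unop, rfl⟩
  · rintro ⟨g, rfl⟩
    exact ⟨MulOpposite.op g, rfl⟩

theorem arrow_act (g : G) (z : P × P) :
    B.arrow (MulOpposite.op g • z.1, MulOpposite.op g • z.2) = B.arrow z := B.arrow_eq_arrow.2 ⟨g, rfl⟩

theorem continuous_arrow : Continuous B.arrow := continuous_quot_mk

theorem isOpenQuotientMap_arrow : IsOpenQuotientMap B.arrow := by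
  have : ContinuousConstSMul Gᵐᵒᵖ (P × P) := by
    refine ⟨fun g => ?_⟩
    have h : Continuous fun p : P => MulOpposite.op g.unop • p :=
      B.contMDiff_act.continuous.comp (continuous_id.prodMk continuous_const)
    exact (h.comp continuous_fst).prodMk (h.comp continuous_snd)
  exact ⟨B.arrow_surjective, B.continuous_arrow, isOpenMap_quotient_mk'_mul⟩

/-- The source map `(p, q) ↦ π(q)`. -/
def gaugeSrc : B.GaugeSpace → M :=
  Quotient.lift (fun z : P × P => B.proj z.2) (by rintro _ w ⟨g, rfl⟩; exact B.proj_act w.2 g.unop)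

/-- The target map `(p, q) ↦ π(p)`. -/
def gaugeTgt : B.GaugeSpace → M :=
  Quotient.lift (fun z : P × P => B.proj z.1) (by rintro _ w ⟨g, rfl⟩; exact B.proj_act w.1 g.unop)

@[simp] theorem gaugeSrc_arrow (z : P × P) : B.gaugeSrc (B.arrow z) = B.proj z.2 := rfl
@[simp] theorem gaugeTgt_arrow (z : P × P) : B.gaugeTgt (B.arrow z) = B.proj z.1 := rfl

theorem continuous_gaugeSrc : Continuous B.gaugeSrc :=
  (B.contMDiff_proj.continuous.comp continuous_snd).quotient_lift _

theorem continuous_gaugeTgt : Continuous B.gaugeTgt :=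
  (B.contMDiff_proj.continuous.comp continuous_fst).quotient_lift _

theorem proj_surjective : Surjective B.proj := by
  intro x
  obtain ⟨e, hx, -⟩ := B.exists_trivialization x
  exact ⟨_, e.proj_symm_apply' (x := 1) hx⟩

/-- The unit `x ↦ [(p, p)]`, where `p` is any point over `x`. -/
def gaugeUnit (x : M) : B.GaugeSpace :=
  B.arrow ((B.proj_surjective x).choose, (B.proj_surjective x).choose)

theorem gaugeUnit_proj (p : P) : B.gaugeUnit (B.proj p) = B.arrow (p, p) := by
  obtain ⟨g, hg⟩ := B.exists_act_eq (B.proj_surjective (B.proj p)).choose_spec.symm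
  rw [gaugeUnit, hg]
  exact B.arrow_act g (p, p)

/-- The inversion `[(p, q)] ↦ [(q, p)]`. -/
def gaugeInv : B.GaugeSpace → B.GaugeSpace :=
  Quotient.lift (fun z : P × P => B.arrow (z.2, z.1))
    (by rintro _ w ⟨g, rfl⟩; exact B.arrow_act g.unop (w.2, w.1))

@[simp] theorem gaugeInv_arrow (z : P × P) : B.gaugeInv (B.arrow z) = B.arrow (z.2, z.1) := rfl

theorem exists_act_out {g h : B.GaugeSpace} (c : B.gaugeSrc g = B.gaugeTgt h) :
    ∃ a : G, (Quotient.out g).2 = MulOpposite.op a • (Quotient.out h).1 := by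
  refine B.exists_act_eq ?_
  have hg : B.arrow (Quotient.out g) = g := Quotient.out_eq g
  have hh : B.arrow (Quotient.out h) = h := Quotient.out_eq h
  rw [← hg, ← hh] at c
  exact c.symm

/-- The multiplication `[(p, q)] [(q', r)] = [(p, r a)]`, where `q = q' a` with `a` in `G`. -/
def gaugeMul (g h : B.GaugeSpace) (c : B.gaugeSrc g = B.gaugeTgt h) : B.GaugeSpace :=
  B.arrow ((Quotient.out g).1, MulOpposite.op (B.exists_act_out c).choose • (Quotient.out h).2)

theorem gaugeMul_arrow (p q r : P) :
    B.gaugeMul (B.arrow (p, q)) (B.arrow (q, r)) rfl = B.arrow (p, r) := by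
  set z := Quotient.out (B.arrow (p, q)) with hz
  set w := Quotient.out (B.arrow (q, r)) with hw
  obtain ⟨b, hb⟩ := B.arrow_eq_arrow.1 (show B.arrow z = B.arrow (p, q) from Quotient.out_eq _)
  obtain ⟨d, hd⟩ := B.arrow_eq_arrow.1 (show B.arrow w = B.arrow (q, r) from Quotient.out_eq _)
  have ha := (B.exists_act_out (g := B.arrow (p, q)) (h := B.arrow (q, r)) rfl).choose_spec
  set a := (B.exists_act_out (g := B.arrow (p, q)) (h := B.arrow (q, r)) rfl).choose
  rw [← hz, ← hw, hb, hd] at ha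
  change B.arrow (z.1, MulOpposite.op a • w.2) = _
  rw [hb, hd]
  simp only [smul_smul, ← MulOpposite.op_mul] at ha ⊢
  rw [← B.act_injective q ha]
  exact B.arrow_act b (p, r)

theorem exists_arrow_eq {g h : B.GaugeSpace} (c : B.gaugeSrc g = B.gaugeTgt h) (z : P × P)
    (hz : B.arrow z = g) : ∃ r : P, h = B.arrow (z.2, r) := by
  obtain ⟨w, rfl⟩ := B.arrow_surjective h
  subst hz
  obtain ⟨a, ha⟩ := B.exists_act_eq (p := w.1) (q := z.2) c.symm
  exact ⟨MulOpposite.op a • w.2, ha ▸ (B.arrow_act a w).symm⟩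

/-- The gauge groupoid `(P × P) / G ⇉ M`, as a groupoid. -/
def gaugeGroupoidOver : GroupoidOver B.GaugeSpace M where
  src := B.gaugeSrc
  tgt := B.gaugeTgt
  unit := B.gaugeUnit
  inv := B.gaugeInv
  mul := B.gaugeMul
  src_unit x := (B.proj_surjective x).choose_spec
  tgt_unit x := (B.proj_surjective x).choose_spec
  src_inv g := by obtain ⟨z, rfl⟩ := B.arrow_surjective g; rfl
  tgt_inv g := by obtain ⟨z, rfl⟩ := B.arrow_surjective g; rfl
  src_mul g h c := by
    obtain ⟨z, rfl⟩ := B.arrow_surjective g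
    obtain ⟨r, rfl⟩ := B.exists_arrow_eq c z rfl
    exact (congrArg B.gaugeSrc (B.gaugeMul_arrow z.1 z.2 r) :)
  tgt_mul g h c := by
    obtain ⟨z, rfl⟩ := B.arrow_surjective g
    obtain ⟨r, rfl⟩ := B.exists_arrow_eq c z rfl
    exact (congrArg B.gaugeTgt (B.gaugeMul_arrow z.1 z.2 r) :)
  mul_assoc g h k c d := by
    obtain ⟨⟨p, q⟩, rfl⟩ := B.arrow_surjective g
    obtain ⟨r, rfl⟩ := B.exists_arrow_eq c (p, q) rfl
    obtain ⟨s, rfl⟩ := B.exists_arrow_eq d (q, r) rfl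
    simp only [B.gaugeMul_arrow]
  unit_mul g := by
    obtain ⟨⟨p, q⟩, rfl⟩ := B.arrow_surjective g
    simp only [B.gaugeTgt_arrow, B.gaugeUnit_proj, B.gaugeMul_arrow]
  mul_unit g := by
    obtain ⟨⟨p, q⟩, rfl⟩ := B.arrow_surjective g
    simp only [B.gaugeSrc_arrow, B.gaugeUnit_proj, B.gaugeMul_arrow]
  inv_mul g := by
    obtain ⟨⟨p, q⟩, rfl⟩ := B.arrow_surjective g
    simp only [B.gaugeSrc_arrow, B.gaugeInv_arrow, B.gaugeUnit_proj, B.gaugeMul_arrow]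
  mul_inv g := by
    obtain ⟨⟨p, q⟩, rfl⟩ := B.arrow_surjective g
    simp only [B.gaugeTgt_arrow, B.gaugeInv_arrow, B.gaugeUnit_proj, B.gaugeMul_arrow]

section Charts

variable {B}
variable {e e' : Trivialization G B.proj}

/-- The map `(p, q) ↦ (π(p), γ(p) γ'(q)⁻¹, π(q))`, where `γ` and `γ'` are the components in `G` of
two principal trivializations. -/
def locTriv (e e' : Trivialization G B.proj) (z : P × P) : M × G × M :=
  (B.proj z.1, (e z.1).2 * (e' z.2).2⁻¹, B.proj z.2)

/-- The local section of `P × P → (P × P) / G` given by two principal trivializations. -/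
def locSec (e e' : Trivialization G B.proj) (y : M × G × M) : P × P :=
  (e.toOpenPartialHomeomorph.symm (y.1, y.2.1), e'.toOpenPartialHomeomorph.symm (y.2.2, 1))

theorem locTriv_out
    (he : IsPrincipalTrivialization IM IG IP e) (he' : IsPrincipalTrivialization IM IG IP e')
    {z : P × P} (h1 : B.proj z.1 ∈ e.baseSet) (h2 : B.proj z.2 ∈ e'.baseSet) :
    locTriv e e' (Quotient.out (B.arrow z)) = locTriv e e' z := by
  obtain ⟨g, hg⟩ := B.arrow_eq_arrow.1 (show B.arrow (Quotient.out (B.arrow z)) = B.arrow z from Quotient.out_eq _)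
  rw [hg]
  simp only [locTriv, B.proj_act, he.map_act _ (e.mem_source.2 h1),
    he'.map_act _ (e'.mem_source.2 h2)]
  refine Prod.ext rfl (Prod.ext ?_ rfl)
  simp only
  group

theorem locTriv_locSec {y : M × G × M} (h1 : y.1 ∈ e.baseSet) (h2 : y.2.2 ∈ e'.baseSet) :
    locTriv e e' (locSec e e' y) = y := by
  simp only [locTriv, locSec]
  rw [e.proj_symm_apply' h1, e'.proj_symm_apply' h2, e.apply_symm_apply' h1,
    e'.apply_symm_apply' h2]
  simp

theorem proj_locSec_fst {y : M × G × M} (h1 : y.1 ∈ e.baseSet) :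
    B.proj (locSec e e' y).1 = y.1 := e.proj_symm_apply' h1

theorem proj_locSec_snd {y : M × G × M} (h2 : y.2.2 ∈ e'.baseSet) :
    B.proj (locSec e e' y).2 = y.2.2 := e'.proj_symm_apply' h2

theorem arrow_locSec_locTriv
    (he : IsPrincipalTrivialization IM IG IP e) (he' : IsPrincipalTrivialization IM IG IP e')
    {z : P × P} (h1 : B.proj z.1 ∈ e.baseSet)
    (h2 : B.proj z.2 ∈ e'.baseSet) : B.arrow (locSec e e' (locTriv e e' z)) = B.arrow z := by
  refine B.arrow_eq_arrow.2 ⟨(e' z.2).2⁻¹, Prod.ext ?_ ?_⟩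
  · refine B.eq_of_trivialization (e := e) ?_ ?_ ?_
    · rw [B.proj_act]; exact proj_locSec_fst (e' := e') (y := locTriv e e' z) h1
    · rwa [proj_locSec_fst (e' := e') (y := locTriv e e' z) h1]
    · rw [he.map_act _ (e.mem_source.2 h1)]
      exact congrArg Prod.snd (e.apply_symm_apply' h1)
  · refine B.eq_of_trivialization (e := e') ?_ ?_ ?_
    · rw [B.proj_act]; exact proj_locSec_snd (e := e) (y := locTriv e e' z) h2
    · rwa [proj_locSec_snd (e := e) (y := locTriv e e' z) h2]
    · rw [he'.map_act _ (e'.mem_source.2 h2), mul_inv_cancel]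
      exact congrArg Prod.snd (e'.apply_symm_apply' h2)

/-- The open set of pairs on which both trivializations are defined. -/
def locDom (e e' : Trivialization G B.proj) : Set (P × P) :=
  {z | B.proj z.1 ∈ e.baseSet ∧ B.proj z.2 ∈ e'.baseSet}

theorem isOpen_locDom : IsOpen (locDom e e') :=
  (e.open_baseSet.preimage (B.contMDiff_proj.continuous.comp continuous_fst)).inter
    (e'.open_baseSet.preimage (B.contMDiff_proj.continuous.comp continuous_snd))

theorem isOpen_locTgt : IsOpen {y : M × G × M | y.1 ∈ e.baseSet ∧ y.2.2 ∈ e'.baseSet} :=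
  (e.open_baseSet.preimage continuous_fst).inter
    (e'.open_baseSet.preimage (continuous_snd.comp continuous_snd))

theorem contMDiffOn_locTriv [LieGroup IG ∞ G]
    (he : IsPrincipalTrivialization IM IG IP e) (he' : IsPrincipalTrivialization IM IG IP e') :
    ContMDiffOn (IP.prod IP) (IM.prod (IG.prod IM)) ∞ (locTriv e e') (locDom e e') := by
  have h1 : ContMDiffOn (IP.prod IP) (IM.prod IG) ∞ (fun z : P × P => e z.1) (locDom e e') :=
    he.contMDiffOn.comp contMDiffOn_fst fun z hz => e.mem_source.2 hz.1
  have h2 : ContMDiffOn (IP.prod IP) (IM.prod IG) ∞ (fun z : P × P => e' z.2) (locDom e e') :=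
    he'.contMDiffOn.comp contMDiffOn_snd fun z hz => e'.mem_source.2 hz.2
  refine (B.contMDiff_proj.comp_contMDiffOn contMDiffOn_fst).prodMk (ContMDiffOn.prodMk ?_
    (B.contMDiff_proj.comp_contMDiffOn contMDiffOn_snd))
  exact (contMDiff_snd.comp_contMDiffOn h1).mul (contMDiff_snd.comp_contMDiffOn h2).inv

theorem contMDiffOn_locSec
    (he : IsPrincipalTrivialization IM IG IP e) (he' : IsPrincipalTrivialization IM IG IP e') :
    ContMDiffOn (IM.prod (IG.prod IM)) (IP.prod IP) ∞ (locSec e e')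
      {y | y.1 ∈ e.baseSet ∧ y.2.2 ∈ e'.baseSet} := by
  refine ContMDiffOn.prodMk (he.contMDiffOn_symm.comp (t := e.target)
    (contMDiffOn_fst.prodMk (contMDiff_fst.comp_contMDiffOn contMDiffOn_snd))
    fun y hy => e.mem_target.2 hy.1)
    (he'.contMDiffOn_symm.comp (t := e'.target)
    ((contMDiff_snd.comp_contMDiffOn contMDiffOn_snd).prodMk contMDiffOn_const)
    fun y hy => e'.mem_target.2 hy.2)

/-- The local trivialization `(p, q) ↦ (π(p), γ(p) γ'(q)⁻¹, π(q))` of `(P × P) / G`. -/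
def gaugeTriv [LieGroup IG ∞ G] (e e' : Trivialization G B.proj)
    (he : IsPrincipalTrivialization IM IG IP e) (he' : IsPrincipalTrivialization IM IG IP e') :
    OpenPartialHomeomorph B.GaugeSpace (M × G × M) where
  toFun c := locTriv e e' (Quotient.out c)
  invFun y := B.arrow (locSec e e' y)
  source := {c | B.gaugeTgt c ∈ e.baseSet ∧ B.gaugeSrc c ∈ e'.baseSet}
  target := {y | y.1 ∈ e.baseSet ∧ y.2.2 ∈ e'.baseSet}
  map_source' c hc := by
    obtain ⟨z, rfl⟩ := B.arrow_surjective c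
    rw [locTriv_out he he' hc.1 hc.2]
    exact hc
  map_target' y hy :=
    ⟨by simpa [proj_locSec_fst (e' := e') hy.1] using hy.1,
      by simpa [proj_locSec_snd (e := e) hy.2] using hy.2⟩
  left_inv' c hc := by
    obtain ⟨z, rfl⟩ := B.arrow_surjective c
    rw [locTriv_out he he' hc.1 hc.2, arrow_locSec_locTriv he he' hc.1 hc.2]
  right_inv' y hy := by
    rw [locTriv_out he he' ((proj_locSec_fst (e' := e') hy.1).symm ▸ hy.1)
      ((proj_locSec_snd (e := e) hy.2).symm ▸ hy.2), locTriv_locSec hy.1 hy.2]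
  open_source := (e.open_baseSet.preimage B.continuous_gaugeTgt).inter
    (e'.open_baseSet.preimage B.continuous_gaugeSrc)
  open_target := isOpen_locTgt
  continuousOn_toFun := by
    intro c hc
    obtain ⟨z, rfl⟩ := B.arrow_surjective c
    refine ContinuousAt.continuousWithinAt (B.isOpenQuotientMap_arrow.continuousAt_comp_iff.1 ?_)
    have hz : locDom e e' ∈ 𝓝 z := isOpen_locDom.mem_nhds hc
    refine (((contMDiffOn_locTriv he he').continuousOn.continuousAt hz)).congr
      (Filter.eventuallyEq_of_mem hz fun w hw => ?_)
    exact (locTriv_out he he' hw.1 hw.2).symm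
  continuousOn_invFun := B.continuous_arrow.comp_continuousOn (contMDiffOn_locSec he he').continuousOn

end Charts

variable [LieGroup IG ∞ G]

/-- The smooth atlas of `(P × P) / G`, modelled on `M × G × M`. -/
instance : ChartedSpace (ModelProd HM (ModelProd HG HM)) B.GaugeSpace where
  atlas := {f | ∃ (e e' : Trivialization G B.proj) (he : IsPrincipalTrivialization IM IG IP e)
    (he' : IsPrincipalTrivialization IM IG IP e') (y : M × G × M),
    f = (gaugeTriv e e' he he').trans (chartAt (ModelProd HM (ModelProd HG HM)) y)}
  chartAt c := (gaugeTriv _ _ (B.exists_trivialization (B.gaugeTgt c)).choose_spec.2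
    (B.exists_trivialization (B.gaugeSrc c)).choose_spec.2).trans
      (chartAt (ModelProd HM (ModelProd HG HM)) (gaugeTriv _ _
        (B.exists_trivialization (B.gaugeTgt c)).choose_spec.2
        (B.exists_trivialization (B.gaugeSrc c)).choose_spec.2 c))
  mem_chart_source c := by
    rw [OpenPartialHomeomorph.trans_source]
    exact ⟨⟨(B.exists_trivialization (B.gaugeTgt c)).choose_spec.1,
      (B.exists_trivialization (B.gaugeSrc c)).choose_spec.1⟩, mem_chart_source (ModelProd HM (ModelProd HG HM)) (_ : M × G × M)⟩
  chart_mem_atlas c := ⟨_, _, _, _, _, rfl⟩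

variable {B} in
theorem gaugeTriv_arrow {e e' : Trivialization G B.proj} (he : IsPrincipalTrivialization IM IG IP e)
    (he' : IsPrincipalTrivialization IM IG IP e') {z : P × P} (hz : z ∈ locDom e e') :
    gaugeTriv e e' he he' (B.arrow z) = locTriv e e' z := locTriv_out he he' hz.1 hz.2

variable [IsManifold IM ∞ M]

/-- The transition maps of this atlas are smooth. -/
instance : IsManifold (IM.prod (IG.prod IM)) ∞ B.GaugeSpace := by
  refine isManifold_of_contDiffOn _ _ _ ?_
  rintro _ _ ⟨e₁, e₁', he₁, he₁', y₁, rfl⟩ ⟨e₂, e₂', he₂, he₂', y₂, rfl⟩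
  rw [← contMDiffOn_iff_contDiffOn]
  set I := IM.prod (IG.prod IM)
  have hI1 : ContMDiff I 𝓘(ℝ, _) ∞ I := I.contMDiff
  have hI2 := I.contMDiffOn_symm (n := ∞)
  have hc1 : ContMDiffOn I I ∞ (chartAt (ModelProd HM (ModelProd HG HM)) y₁).symm _ :=
    contMDiffOn_chart_symm
  have hc2 : ContMDiffOn I I ∞ (chartAt (ModelProd HM (ModelProd HG HM)) y₂) _ :=
    contMDiffOn_chart
  have hs := contMDiffOn_locSec he₁ he₁'
  have ht := contMDiffOn_locTriv he₂ he₂'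
  have key := hI1.comp_contMDiffOn (hc2.comp' (ht.comp' (hs.comp' (hc1.comp' hI2))))
  refine (key.mono ?_).congr ?_
  · rintro x ⟨hx, hx'⟩
    simp only [mfld_simps] at hx
    obtain ⟨⟨h1, h2⟩, h3, h4⟩ := hx
    have h5 := gaugeTriv_arrow he₂ he₂' (z := locSec e₁ e₁' ((chartAt _ y₁).symm (I.symm x))) h3
    refine ⟨⟨⟨⟨hx', h1⟩, h2⟩, h3⟩, ?_⟩
    exact (congrArg (fun y => y ∈ (chartAt (ModelProd HM (ModelProd HG HM)) y₂).source) h5).mp h4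
  · rintro x ⟨hx, hx'⟩
    simp only [mfld_simps] at hx
    obtain ⟨⟨h1, h2⟩, h3, h4⟩ := hx
    have h5 := gaugeTriv_arrow he₂ he₂' (z := locSec e₁ e₁' ((chartAt _ y₁).symm (I.symm x))) h3
    exact congrArg (fun y => I (chartAt (ModelProd HM (ModelProd HG HM)) y₂ y)) h5

section Smooth

variable {B} {e e' : Trivialization G B.proj} (he : IsPrincipalTrivialization IM IG IP e)
    (he' : IsPrincipalTrivialization IM IG IP e')

theorem contMDiffOn_gaugeTriv :
    ContMDiffOn (IM.prod (IG.prod IM)) (IM.prod (IG.prod IM)) ∞ (gaugeTriv e e' he he')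
      (gaugeTriv e e' he he').source := by
  intro c hc
  set y := gaugeTriv e e' he he' c with hy
  set ψ := (gaugeTriv e e' he he').trans (chartAt (ModelProd HM (ModelProd HG HM)) y) with hψ
  have hm : ψ ∈ IsManifold.maximalAtlas (IM.prod (IG.prod IM)) ∞ B.GaugeSpace :=
    IsManifold.subset_maximalAtlas ⟨e, e', he, he', y, rfl⟩
  have h1 := contMDiffOn_of_mem_maximalAtlas hm
  have h2 : ContMDiffOn (IM.prod (IG.prod IM)) (IM.prod (IG.prod IM)) ∞
    (chartAt (ModelProd HM (ModelProd HG HM)) y).symm _ := contMDiffOn_chart_symm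
  have hcψ : c ∈ ψ.source := by
    rw [hψ, OpenPartialHomeomorph.trans_source]
    exact ⟨hc, mem_chart_source (ModelProd HM (ModelProd HG HM)) y⟩
  refine ContMDiffAt.contMDiffWithinAt ?_
  have h3 := (h2.comp' h1).contMDiffAt (x := c) (Filter.inter_mem (ψ.open_source.mem_nhds hcψ)
    (Filter.mem_of_superset (ψ.open_source.mem_nhds hcψ) fun d hd => ?_))
  · refine h3.congr_of_eventuallyEq (Filter.eventuallyEq_of_mem (ψ.open_source.mem_nhds hcψ) ?_)
    intro d hd
    rw [hψ, OpenPartialHomeomorph.trans_source] at hd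
    exact ((chartAt (ModelProd HM (ModelProd HG HM)) y).left_inv hd.2).symm
  · rw [hψ, OpenPartialHomeomorph.trans_source] at hd
    exact (chartAt (ModelProd HM (ModelProd HG HM)) y).map_source hd.2

theorem contMDiffOn_gaugeTriv_symm :
    ContMDiffOn (IM.prod (IG.prod IM)) (IM.prod (IG.prod IM)) ∞ (gaugeTriv e e' he he').symm
      (gaugeTriv e e' he he').target := by
  intro y hy
  set ψ := (gaugeTriv e e' he he').trans (chartAt (ModelProd HM (ModelProd HG HM)) y) with hψ
  have hm : ψ ∈ IsManifold.maximalAtlas (IM.prod (IG.prod IM)) ∞ B.GaugeSpace :=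
    IsManifold.subset_maximalAtlas ⟨e, e', he, he', y, rfl⟩
  have h1 := contMDiffOn_symm_of_mem_maximalAtlas hm
  have h2 : ContMDiffOn (IM.prod (IG.prod IM)) (IM.prod (IG.prod IM)) ∞
    (chartAt (ModelProd HM (ModelProd HG HM)) y) _ := contMDiffOn_chart
  set S := (gaugeTriv e e' he he').target ∩ (chartAt (ModelProd HM (ModelProd HG HM)) y).source
  have hS : S ∈ 𝓝 y := Filter.inter_mem ((gaugeTriv e e' he he').open_target.mem_nhds hy)
    (chart_source_mem_nhds _ _)
  refine ContMDiffAt.contMDiffWithinAt ?_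
  have h3 := (h1.comp' h2).contMDiffAt (x := y) (Filter.mem_of_superset hS fun d hd => ?_)
  · refine h3.congr_of_eventuallyEq (Filter.eventuallyEq_of_mem hS fun d hd => ?_)
    exact congrArg (gaugeTriv e e' he he').symm
      ((chartAt (ModelProd HM (ModelProd HG HM)) y).left_inv hd.2).symm
  · refine ⟨hd.2, ?_⟩
    rw [mem_preimage, hψ, OpenPartialHomeomorph.trans_target]
    refine ⟨(chartAt (ModelProd HM (ModelProd HG HM)) y).map_source hd.2, ?_⟩
    rw [mem_preimage, (chartAt (ModelProd HM (ModelProd HG HM)) y).left_inv hd.2]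
    exact hd.1

end Smooth

theorem contMDiff_arrow : ContMDiff (IP.prod IP) (IM.prod (IG.prod IM)) ∞ B.arrow := by
  intro z
  obtain ⟨e, h1, he⟩ := B.exists_trivialization (B.proj z.1)
  obtain ⟨e', h2, he'⟩ := B.exists_trivialization (B.proj z.2)
  have hz : locDom e e' ∈ 𝓝 z := isOpen_locDom.mem_nhds ⟨h1, h2⟩
  have h := ((contMDiffOn_gaugeTriv_symm he he').comp (contMDiffOn_locTriv he he')
    fun w hw => hw).contMDiffAt hz
  exact h.congr_of_eventuallyEq (Filter.eventuallyEq_of_mem hz fun w hw =>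
    (arrow_locSec_locTriv he he' hw.1 hw.2).symm)

/-- Near every point, the quotient map `P × P → (P × P) / G` has a smooth section. -/
theorem exists_section (c : B.GaugeSpace) : ∃ σ : B.GaugeSpace → P × P,
    ContMDiffAt (IM.prod (IG.prod IM)) (IP.prod IP) ∞ σ c ∧ ∀ᶠ d in 𝓝 c, B.arrow (σ d) = d := by
  obtain ⟨e, h1, he⟩ := B.exists_trivialization (B.gaugeTgt c)
  obtain ⟨e', h2, he'⟩ := B.exists_trivialization (B.gaugeSrc c)
  have hc : (gaugeTriv e e' he he').source ∈ 𝓝 c :=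
    (gaugeTriv e e' he he').open_source.mem_nhds ⟨h1, h2⟩
  refine ⟨locSec e e' ∘ gaugeTriv e e' he he', ?_, Filter.eventually_of_mem hc fun d hd =>
    (gaugeTriv e e' he he').left_inv hd⟩
  exact ((contMDiffOn_locSec he he').comp (contMDiffOn_gaugeTriv he he')
    fun d hd => (gaugeTriv e e' he he').map_source hd).contMDiffAt hc

variable {B} in
/-- A map on `(P × P) / G` is smooth if it is smooth as a map on `P × P`. -/
theorem contMDiff_of_comp_arrow {EN HN N : Type*} [NormedAddCommGroup EN] [NormedSpace ℝ EN]
    [TopologicalSpace HN] {IN : ModelWithCorners ℝ EN HN} [TopologicalSpace N] [ChartedSpace HN N]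
    {f : B.GaugeSpace → N} (hf : ContMDiff (IP.prod IP) IN ∞ (f ∘ B.arrow)) :
    ContMDiff (IM.prod (IG.prod IM)) IN ∞ f := by
  intro c
  obtain ⟨σ, h1, h2⟩ := B.exists_section c
  refine ((hf _).comp c h1).congr_of_eventuallyEq ?_
  filter_upwards [h2] with d hd
  exact congrArg f hd.symm

theorem contMDiff_gaugeSrc : ContMDiff (IM.prod (IG.prod IM)) IM ∞ B.gaugeSrc :=
  contMDiff_of_comp_arrow (B.contMDiff_proj.comp contMDiff_snd)

theorem contMDiff_gaugeTgt : ContMDiff (IM.prod (IG.prod IM)) IM ∞ B.gaugeTgt :=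
  contMDiff_of_comp_arrow (B.contMDiff_proj.comp contMDiff_fst)

theorem submersion_gaugeSrc (c : B.GaugeSpace) :
    Surjective (mfderiv (IM.prod (IG.prod IM)) IM B.gaugeSrc c) := by
  obtain ⟨z, rfl⟩ := B.arrow_surjective c
  intro v
  obtain ⟨w, hw⟩ := B.surjective_mfderiv_proj z.2 v
  have h1 : HasMFDerivAt (IP.prod IP) IM (B.gaugeSrc ∘ B.arrow) z _ :=
    HasMFDerivAt.comp z ((B.contMDiff_gaugeSrc _).mdifferentiableAt (by simp)).hasMFDerivAt
      ((B.contMDiff_arrow z).mdifferentiableAt (by simp)).hasMFDerivAt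
  have h2 : HasMFDerivAt (IP.prod IP) IM (B.proj ∘ Prod.snd) z _ :=
    HasMFDerivAt.comp z ((B.contMDiff_proj _).mdifferentiableAt (by simp)).hasMFDerivAt
      (hasMFDerivAt_snd z)
  have h3 := DFunLike.congr_fun (hasMFDerivAt_unique h1 h2) ((0, w) : EP × EP)
  exact ⟨_, h3.trans hw⟩

theorem submersion_gaugeTgt (c : B.GaugeSpace) :
    Surjective (mfderiv (IM.prod (IG.prod IM)) IM B.gaugeTgt c) := by
  obtain ⟨z, rfl⟩ := B.arrow_surjective c
  intro v
  obtain ⟨w, hw⟩ := B.surjective_mfderiv_proj z.1 v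
  have h1 : HasMFDerivAt (IP.prod IP) IM (B.gaugeTgt ∘ B.arrow) z _ :=
    HasMFDerivAt.comp z ((B.contMDiff_gaugeTgt _).mdifferentiableAt (by simp)).hasMFDerivAt
      ((B.contMDiff_arrow z).mdifferentiableAt (by simp)).hasMFDerivAt
  have h2 : HasMFDerivAt (IP.prod IP) IM (B.proj ∘ Prod.fst) z _ :=
    HasMFDerivAt.comp z ((B.contMDiff_proj _).mdifferentiableAt (by simp)).hasMFDerivAt
      (hasMFDerivAt_fst z)
  have h3 := DFunLike.congr_fun (hasMFDerivAt_unique h1 h2) ((w, 0) : EP × EP)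
  exact ⟨_, h3.trans hw⟩

theorem contMDiff_gaugeUnit : ContMDiff IM (IM.prod (IG.prod IM)) ∞ B.gaugeUnit := by
  intro x
  obtain ⟨e, hx, he⟩ := B.exists_trivialization x
  have hb := e.open_baseSet.mem_nhds hx
  have h1 : ContMDiffOn IM IP ∞ (fun y => e.toOpenPartialHomeomorph.symm (y, 1)) e.baseSet :=
    he.contMDiffOn_symm.comp (t := e.target) (contMDiffOn_id.prodMk contMDiffOn_const)
      fun y hy => e.mem_target.2 hy
  refine (((B.contMDiff_arrow).comp_contMDiffOn (h1.prodMk h1)).contMDiffAt hb).congr_of_eventuallyEq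
    (Filter.eventuallyEq_of_mem hb fun y hy => ?_)
  have h2 := B.gaugeUnit_proj (e.toOpenPartialHomeomorph.symm (y, 1))
  rwa [e.proj_symm_apply' hy] at h2

theorem contMDiffOn_gaugeMul :
    ContMDiffOn ((IM.prod (IG.prod IM)).prod (IM.prod (IG.prod IM))) (IM.prod (IG.prod IM)) ∞
      B.gaugeGroupoidOver.mulExt B.gaugeGroupoidOver.composable := by
  rintro ⟨g, h⟩ c
  have hgh : B.gaugeSrc g = B.gaugeTgt h := c
  obtain ⟨σ, hσ, hσ'⟩ := B.exists_section g
  obtain ⟨τ, hτ, hτ'⟩ := B.exists_section h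
  obtain ⟨e, hx, he⟩ := B.exists_trivialization (B.gaugeSrc g)
  have hq : (σ g).2 ∈ e.source := e.mem_source.2 (by
    rw [← B.gaugeSrc_arrow, hσ'.self_of_nhds]; exact hx)
  have hq' : (τ h).1 ∈ e.source := e.mem_source.2 (by
    rw [← B.gaugeTgt_arrow, hτ'.self_of_nhds, ← hgh]; exact hx)
  let J := IM.prod (IG.prod IM)
  have s1 : ContMDiffAt (J.prod J) (IP.prod IP) ∞
      (fun x : B.GaugeSpace × B.GaugeSpace => σ x.1) (g, h) :=
    ContMDiffAt.comp (g, h) (g := σ) (f := Prod.fst) hσ contMDiffAt_fst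
  have s2 : ContMDiffAt (J.prod J) (IP.prod IP) ∞
      (fun x : B.GaugeSpace × B.GaugeSpace => τ x.2) (g, h) :=
    ContMDiffAt.comp (g, h) (g := τ) (f := Prod.snd) hτ contMDiffAt_snd
  have s3 : ContMDiffAt (J.prod J) IP ∞
      (fun x : B.GaugeSpace × B.GaugeSpace => (σ x.1).2) (g, h) := contMDiffAt_snd.comp _ s1
  have s4 : ContMDiffAt (J.prod J) IP ∞
      (fun x : B.GaugeSpace × B.GaugeSpace => (τ x.2).1) (g, h) := contMDiffAt_fst.comp _ s2
  have s5 : ContMDiffAt (J.prod J) IG ∞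
      (fun x : B.GaugeSpace × B.GaugeSpace => (e (σ x.1).2).2) (g, h) :=
    contMDiffAt_snd.comp _ (ContMDiffAt.comp (g, h) (g := e)
      ((he.contMDiffOn _ hq).contMDiffAt (e.open_source.mem_nhds hq)) s3)
  have s6 : ContMDiffAt (J.prod J) IG ∞
      (fun x : B.GaugeSpace × B.GaugeSpace => (e (τ x.2).1).2) (g, h) :=
    contMDiffAt_snd.comp _ (ContMDiffAt.comp (g, h) (g := e)
      ((he.contMDiffOn _ hq').contMDiffAt (e.open_source.mem_nhds hq')) s4)
  have s7 : ContMDiffAt (J.prod J) J ∞ (fun x : B.GaugeSpace × B.GaugeSpace =>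
      B.arrow ((σ x.1).1, MulOpposite.op ((e (τ x.2).1).2⁻¹ * (e (σ x.1).2).2) • (τ x.2).2))
      (g, h) :=
    (B.contMDiff_arrow _).comp _ ((contMDiffAt_fst.comp _ s1).prodMk
      ((B.contMDiff_act _).comp _ ((contMDiffAt_snd.comp _ s2).prodMk (s6.inv.mul s5))))
  have n1 : ∀ᶠ x : B.GaugeSpace × B.GaugeSpace in 𝓝 (g, h), B.arrow (σ x.1) = x.1 :=
    (continuous_fst.tendsto (g, h)).eventually hσ'
  have n2 : ∀ᶠ x : B.GaugeSpace × B.GaugeSpace in 𝓝 (g, h), B.arrow (τ x.2) = x.2 :=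
    (continuous_snd.tendsto (g, h)).eventually hτ'
  have n3 : ∀ᶠ x : B.GaugeSpace × B.GaugeSpace in 𝓝 (g, h), B.proj (τ x.2).1 ∈ e.baseSet :=
    (B.contMDiff_proj.continuous.continuousAt.comp s4.continuousAt).eventually
      (e.open_baseSet.mem_nhds (e.mem_source.1 hq'))
  have key : ∀ x : B.GaugeSpace × B.GaugeSpace, x ∈ B.gaugeGroupoidOver.composable →
      B.arrow (σ x.1) = x.1 → B.arrow (τ x.2) = x.2 → B.proj (τ x.2).1 ∈ e.baseSet →
      B.gaugeGroupoidOver.mulExt x =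
        B.arrow ((σ x.1).1, MulOpposite.op ((e (τ x.2).1).2⁻¹ * (e (σ x.1).2).2) • (τ x.2).2) := by
    rintro ⟨k, l⟩ hx hk hl hm
    have hx' : B.gaugeSrc k = B.gaugeTgt l := hx
    set a := (e (τ l).1).2⁻¹ * (e (σ k).2).2 with ha
    have hp : B.proj (σ k).2 = B.proj (τ l).1 := by
      rw [← B.gaugeSrc_arrow, ← B.gaugeTgt_arrow, hk, hl, hx']
    have h1 : (σ k).2 = MulOpposite.op a • (τ l).1 := by
      refine B.eq_of_trivialization (e := e) ?_ (hp ▸ hm) ?_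
      · rw [B.proj_act, hp]
      · rw [he.map_act _ (e.mem_source.2 hm), ha]; group
    have h2 : l = B.arrow ((σ k).2, MulOpposite.op a • (τ l).2) := by
      rw [h1]
      exact hl.symm.trans (B.arrow_act a (τ l)).symm
    have h3 : k = B.arrow ((σ k).1, (σ k).2) := hk.symm
    have h4 : B.gaugeGroupoidOver.mulExt (k, l) = B.gaugeMul k l hx' := dif_pos hx
    rw [h4]
    have h5 : ∀ (k' l' : B.GaugeSpace) (c' : B.gaugeSrc k' = B.gaugeTgt l'), k = k' → l = l' →
        B.gaugeMul k l hx' = B.gaugeMul k' l' c' := by rintro _ _ _ rfl rfl; rfl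
    rw [h5 _ _ rfl h3 h2, B.gaugeMul_arrow]
  refine s7.contMDiffWithinAt.congr_of_eventuallyEq ?_
    (key _ c n1.self_of_nhds n2.self_of_nhds n3.self_of_nhds)
  filter_upwards [nhdsWithin_le_nhds n1, nhdsWithin_le_nhds n2, nhdsWithin_le_nhds n3,
    self_mem_nhdsWithin] with x h1 h2 h3 h4 using key x h4 h1 h2 h3

/-- The gauge groupoid `(P × P) / G ⇉ M`, as a Lie groupoid. -/
def gaugeGroupoid : LieGroupoid (IM.prod (IG.prod IM)) IM B.GaugeSpace M where
  toGroupoidOver := B.gaugeGroupoidOver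
  contMDiff_src := B.contMDiff_gaugeSrc
  contMDiff_tgt := B.contMDiff_gaugeTgt
  submersion_src := B.submersion_gaugeSrc
  submersion_tgt := B.submersion_gaugeTgt
  contMDiff_unit := B.contMDiff_gaugeUnit
  contMDiff_inv := contMDiff_of_comp_arrow
    (B.contMDiff_arrow.comp (contMDiff_snd.prodMk contMDiff_fst))
  contMDiffOn_mul := B.contMDiffOn_gaugeMul

variable {B} in
/-- `K` is the vector-valued one-form on the gauge groupoid which corresponds to the principal
connection `θ`: if `Θ(X) = θ(X)_P` is the vertical projection and `[(X, Y)]` denotes the image of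
`(X, Y) ∈ TP × TP` under the derivative of the quotient map `P × P → (P × P) / G`, then
`K [(X, Y)] = [(Θ(X), Θ(Y))]`. -/
def Connection.Induces [IsManifold IP ∞ P] (θ : B.Connection)
    (K : VectorForm (IM.prod (IG.prod IM)) B.GaugeSpace 1) : Prop :=
  ∀ (p q : P) (X : TangentSpace IP p) (Y : TangentSpace IP q),
    K (B.arrow (p, q)) (fun _ =>
        mfderiv (IP.prod IP) (IM.prod (IG.prod IM)) B.arrow (p, q) (X, Y)) =
      mfderiv (IP.prod IP) (IM.prod (IG.prod IM)) B.arrow (p, q)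
        (B.generator (θ.toFun p X) p, B.generator (θ.toFun q Y) q)

end PrincipalBundle
end Principal
end

/-!
Let `Θ` be the vertical projection of the connection. Vector fields on the gauge groupoid need not
lift to fields of the form `(p, q) ↦ (X p, Y q)` on `P × P`, so curvatures are compared pointwise,
along a smooth map `f` and for a projection `K` on its target. If `X`, `Y` are fields on the source
with `K (Tf X) = K (Tf Y) = 0`, then `K (Tf [X, Y])` is the curvature of `K` at `(Tf X, Tf Y)`:
extend the values `Tf X`, `Tf Y` at one point to fields `X'`, `Y'` on the target. In a chart the
defect `Tf X - X' ∘ f` vanishes at that point, so the defect of `X` and `(Id - K) X'` being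
`f`-related has a derivative in the kernel of `K`, and `K` does not see it in the bracket.

With the two projections and the quotient map of `P × P` for `f`, the brackets of `Θ`-horizontal
fields on `P × P` show that `R_K` at `\overline{(X₁, Y₁)}`, `\overline{(X₂, Y₂)}` is
`\overline{(R_Θ(X₁, X₂), R_Θ(Y₁, Y₂))}`; with `π` for `f` they show that `R_Θ` is `π`-related to a
form on `M`.  Multiplicativity follows, since the tangent multiplication sends
`\overline{(X, Y)}`, `\overline{(Y, Z)}` to `\overline{(X, Z)}`, and every composable pair of
tangent vectors has this form because vertical vectors are infinitesimal generators.
-/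

noncomputable section

section ModelDeriv

variable {E E' E'' H H' H'' N N' N'' : Type*}
  [NormedAddCommGroup E] [NormedSpace ℝ E] [TopologicalSpace H] {I : ModelWithCorners ℝ E H}
  [NormedAddCommGroup E'] [NormedSpace ℝ E'] [TopologicalSpace H'] {I' : ModelWithCorners ℝ E' H'}
  [NormedAddCommGroup E''] [NormedSpace ℝ E''] [TopologicalSpace H'']
  {I'' : ModelWithCorners ℝ E'' H''}
  [TopologicalSpace N] [ChartedSpace H N] [TopologicalSpace N'] [ChartedSpace H' N']
  [TopologicalSpace N''] [ChartedSpace H'' N'']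

variable (I I') in
/-- The derivative `mfderiv I I' f x`, as a map between the model spaces.  Its type does not depend
on `x`, so that derivatives at different points can be compared and base points rewritten. -/
def modelDeriv (f : N → N') (x : N) : E →L[ℝ] E' := mfderiv I I' f x

theorem modelDeriv_comp_of_eq {f : N → N'} {g : N' → N''} {x : N} {y : N'}
    (hg : MDiffAt g y) (hf : MDiffAt f x) (hy : f x = y) (v : E) :
    modelDeriv I I'' (fun z => g (f z)) x v = modelDeriv I' I'' g y (modelDeriv I I' f x v) := by
  subst hy
  exact DFunLike.congr_fun (mfderiv_comp x hg hf) v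

theorem modelDeriv_comp {f : N → N'} {g : N' → N''} {x : N}
    (hg : MDiffAt g (f x)) (hf : MDiffAt f x) (v : E) :
    modelDeriv I I'' (fun z => g (f z)) x v = modelDeriv I' I'' g (f x) (modelDeriv I I' f x v) :=
  modelDeriv_comp_of_eq hg hf rfl v

theorem modelDeriv_congr {f g : N → N'} {x : N} (h : f =ᶠ[𝓝 x] g) :
    modelDeriv I I' f x = modelDeriv I I' g x := h.mfderiv_eq

theorem modelDeriv_const (c : N') (x : N) (v : E) : modelDeriv I I' (fun _ : N => c) x v = 0 := by
  rw [modelDeriv, mfderiv_const]; rfl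

theorem modelDeriv_id (x : N) (v : E) : modelDeriv I I (fun y => y) x v = v := by
  exact DFunLike.congr_fun (mfderiv_id (I := I) (x := x)) v

theorem modelDeriv_fst (z : N × N') (v : E × E') :
    modelDeriv (I.prod I') I Prod.fst z v = v.1 := by
  rw [modelDeriv, mfderiv_fst]; rfl

theorem modelDeriv_snd (z : N × N') (v : E × E') :
    modelDeriv (I.prod I') I' Prod.snd z v = v.2 := by
  rw [modelDeriv, mfderiv_snd]; rfl

theorem modelDeriv_prodMk {f : N → N'} {g : N → N''} {x : N} (hf : MDiffAt f x)
    (hg : MDiffAt g x) (v : E) :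
    modelDeriv I (I'.prod I'') (fun y => (f y, g y)) x v =
      (modelDeriv I I' f x v, modelDeriv I I'' g x v) := by
  rw [modelDeriv, mfderiv_prodMk hf hg]; rfl

theorem modelDeriv_sub {f g : N → E'} {x : N} (hf : MDiffAt f x) (hg : MDiffAt g x) (v : E) :
    modelDeriv I 𝓘(ℝ, E') (fun y => f y - g y) x v =
      modelDeriv I 𝓘(ℝ, E') f x v - modelDeriv I 𝓘(ℝ, E') g x v :=
  DFunLike.congr_fun (hf.hasMFDerivAt.sub hg.hasMFDerivAt).mfderiv v

theorem hasFDerivWithinAt_clm_apply_of_eq_zero {A : E → E' →L[ℝ] E''} {f : E → E'}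
    {f' : E →L[ℝ] E'} {s : Set E} {x : E} (hA : ContinuousWithinAt A s x)
    (hf : HasFDerivWithinAt f f' s x) (hfx : f x = 0) :
    HasFDerivWithinAt (fun y => A y (f y)) ((A x).comp f') s x := by
  have hsub : (fun y => (A y - A x) (f y)) =o[𝓝[s] x] fun y => y - x := by
    have hA0 : (fun y => A y - A x) =o[𝓝[s] x] fun _ => (1 : ℝ) := by
      rw [Asymptotics.isLittleO_one_iff, ← sub_self (A x)]
      exact hA.tendsto.sub_const _
    have hfO : f =O[𝓝[s] x] fun y => y - x := by simpa only [hfx, sub_zero] using hf.isBigO_sub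
    have hbound : (fun y => (A y - A x) (f y)) =O[𝓝[s] x] fun y => ‖A y - A x‖ * ‖f y‖ :=
      .of_bound' (.of_forall fun y => by simpa using (A y - A x).le_opNorm (f y))
    simpa using hbound.trans_isLittleO (hA0.norm_left.mul_isBigO hfO.norm_norm)
  have hlin := (A x).isBigO_comp _ _ |>.trans_isLittleO hf.isLittleO
  refine .of_isLittleO ((hsub.add hlin).congr_left fun y => ?_)
  simp [hfx]

theorem modelDeriv_clm_apply_of_eq_zero {A : N → E' →L[ℝ] E''} {f : N → E'} {x : N}
    (hA : ContinuousAt A x) (hf : MDiffAt f x) (hfx : f x = 0) (v : E) :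
    modelDeriv I 𝓘(ℝ, E'') (fun y => A y (f y)) x v = A x (modelDeriv I 𝓘(ℝ, E') f x v) := by
  have hx : (extChartAt I x).symm (extChartAt I x x) = x := extChartAt_to_inv x
  have hAchart : ContinuousAt (A ∘ (extChartAt I x).symm) (extChartAt I x x) :=
    ContinuousAt.comp (hx.symm ▸ hA) (continuousAt_extChartAt_symm x)
  have hderiv : HasMFDerivAt I 𝓘(ℝ, E'') (fun y => A y (f y)) x
      ((A x).comp (modelDeriv I 𝓘(ℝ, E') f x)) := by
    refine ⟨hA.clm_apply hf.continuousAt, ?_⟩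
    have := hasFDerivWithinAt_clm_apply_of_eq_zero hAchart.continuousWithinAt hf.hasMFDerivAt.2
      (by simpa only [writtenInExtChartAt, extChartAt_model_space_eq_id, PartialEquiv.refl_coe,
        comp_apply, hx, id_eq] using hfx)
    rwa [comp_apply, hx] at this
  exact DFunLike.congr_fun hderiv.mfderiv v

end ModelDeriv

section LieBracket

variable {E H E' H' F : Type*} [NormedAddCommGroup E] [NormedSpace ℝ E]
  [TopologicalSpace H] [NormedAddCommGroup E'] [NormedSpace ℝ E'] [TopologicalSpace H']
  [NormedAddCommGroup F] [NormedSpace ℝ F]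
  {I : ModelWithCorners ℝ E H} {I' : ModelWithCorners ℝ E' H'}
  {N N' : Type*} [TopologicalSpace N] [ChartedSpace H N] [IsManifold I ∞ N]
  [TopologicalSpace N'] [ChartedSpace H' N'] [IsManifold I' ∞ N']

theorem eventually_mdifferentiableAt {f : N → N'} {x : N} (hf : CMDiffAt ∞ f x) :
    ∀ᶠ y in 𝓝 x, MDiffAt f y := by
  filter_upwards [(contMDiffAt_iff_contMDiffAt_nhds (n := 1) (by simp)).1 (hf.of_le (by simp))]
    with y hy using hy.mdifferentiableAt one_ne_zero

variable [I.Boundaryless]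

theorem contMDiffAt_extChartAt_symm (x : N) :
    CMDiffAt ∞ (extChartAt I x).symm (extChartAt I x x) := by
  have := contMDiffWithinAt_extChartAt_symm_range (I := I) (n := ∞) x (mem_extChartAt_target x)
  rwa [I.range_eq_univ, contMDiffWithinAt_univ] at this

theorem contDiffAt_comp_extChartAt_symm {x : N} {u : N → F} (hu : CMDiffAt ∞ u x) :
    ContDiffAt ℝ ∞ (u ∘ (extChartAt I x).symm) (extChartAt I x x) :=
  (ContMDiffAt.comp _ ((extChartAt_to_inv (I := I) x).symm ▸ hu)
    (contMDiffAt_extChartAt_symm x)).contDiffAt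

variable (I) in
/-- The vector field `V` in the chart around `x`. -/
def chartField (x : N) (V : ∀ y : N, TangentSpace I y) : E → E :=
  VectorField.mpullback 𝓘(ℝ, E) I (extChartAt I x).symm V

theorem fderiv_comp_extChartAt_symm_chartField {x : N} {z : E} (hz : z ∈ (extChartAt I x).target)
    {u : N → F} (hu : MDiffAt u ((extChartAt I x).symm z)) (V : ∀ y : N, TangentSpace I y) :
    fderiv ℝ (u ∘ (extChartAt I x).symm) z (chartField I x V z) =
      modelDeriv I 𝓘(ℝ, F) u ((extChartAt I x).symm z) (V ((extChartAt I x).symm z)) := by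
  have hinv := isInvertible_mfderivWithin_extChartAt_symm (I := I) hz
  have hdiff := mdifferentiableWithinAt_extChartAt_symm (I := I) hz
  rw [I.range_eq_univ, mfderivWithin_univ] at hinv
  rw [I.range_eq_univ, mdifferentiableWithinAt_univ] at hdiff
  have hchain := modelDeriv_comp hu hdiff (chartField I x V z)
  refine Eq.trans ?_ (hchain.trans (congrArg _ (hinv.self_apply_inverse _)))
  rw [modelDeriv, mfderiv_eq_fderiv]
  rfl

theorem fderiv_comp_extChartAt_symm_chartField_self {x : N} {u : N → F} (hu : MDiffAt u x)
    (V : ∀ y : N, TangentSpace I y) :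
    fderiv ℝ (u ∘ (extChartAt I x).symm) (extChartAt I x x) (chartField I x V (extChartAt I x x)) =
      modelDeriv I 𝓘(ℝ, F) u x (V x) := by
  have hx := extChartAt_to_inv (I := I) x
  rw [fderiv_comp_extChartAt_symm_chartField (mem_extChartAt_target x) (hx.symm ▸ hu), hx]

theorem fderiv_comp_extChartAt_symm_chartField_eventuallyEq {x : N} {u : N → F}
    (hu : CMDiffAt ∞ u x) (V : ∀ y : N, TangentSpace I y) :
    (fun z => fderiv ℝ (u ∘ (extChartAt I x).symm) z (chartField I x V z))
      =ᶠ[𝓝 (extChartAt I x x)]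
        (fun y => modelDeriv I 𝓘(ℝ, F) u y (V y)) ∘ (extChartAt I x).symm := by
  have hsymm : Filter.Tendsto (extChartAt I x).symm (𝓝 (extChartAt I x x)) (𝓝 x) := by
    simpa only [ContinuousAt, extChartAt_to_inv] using
      (contMDiffAt_extChartAt_symm (I := I) x).continuousAt
  filter_upwards [extChartAt_target_mem_nhds (I := I) x,
    hsymm.eventually (eventually_mdifferentiableAt hu)] with z hz huz
    using fderiv_comp_extChartAt_symm_chartField hz huz V

variable [CompleteSpace E]

theorem differentiableAt_chartField {x : N} {V : ∀ y : N, TangentSpace I y}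
    (hV : MDiffAt (T% V) x) : DifferentiableAt ℝ (chartField I x V) (extChartAt I x x) := by
  have h := hV.mdifferentiableWithinAt (s := univ)
    |>.differentiableWithinAt_mpullbackWithin_vectorField
  simp only [I.range_eq_univ, preimage_univ, inter_univ, VectorField.mpullbackWithin_univ] at h
  exact differentiableWithinAt_univ.1 h

theorem chartField_mlieBracket {x : N} {V W : ∀ y : N, TangentSpace I y}
    (hV : MDiffAt (T% V) x) (hW : MDiffAt (T% W) x) :
    chartField I x (VectorField.mlieBracket I V W) (extChartAt I x x) =
      VectorField.lieBracket ℝ (chartField I x V) (chartField I x W) (extChartAt I x x) := by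
  have : IsManifold I (minSmoothness ℝ 2) N := by
    rw [minSmoothness_of_isRCLikeNormedField]; infer_instance
  have hx := extChartAt_to_inv (I := I) x
  refine (VectorField.mpullback_mlieBracket (n := ∞) (hx.symm ▸ hV) (hx.symm ▸ hW)
    (contMDiffAt_extChartAt_symm x) (by simpa using ENat.LEInfty.out)).trans ?_
  rw [← VectorField.mlieBracketWithin_univ, VectorField.mlieBracketWithin_eq_lieBracketWithin]
  exact congrFun (VectorField.lieBracketWithin_univ (𝕜 := ℝ) (E := E)) _

theorem mdifferentiableAt_modelDeriv_apply {x : N} {u : N → F} (hu : CMDiffAt ∞ u x)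
    {V : ∀ y : N, TangentSpace I y} (hV : MDiffAt (T% V) x) :
    MDiffAt (fun y => modelDeriv I 𝓘(ℝ, F) u y (V y)) x := by
  have hchart : DifferentiableAt ℝ (fun z => fderiv ℝ (u ∘ (extChartAt I x).symm) z
      (chartField I x V z)) (extChartAt I x x) :=
    (((contDiffAt_comp_extChartAt_symm hu).fderiv_right (m := 1)
      (one_add_one_eq_two.trans_le ENat.LEInfty.out)).differentiableAt
      one_ne_zero).clm_apply (differentiableAt_chartField hV)
  refine (hchart.mdifferentiableAt.comp x
    (mdifferentiableAt_extChartAt (mem_chart_source H x))).congr_of_eventuallyEq ?_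
  filter_upwards [extChartAt_source_mem_nhds (I := I) x, eventually_mdifferentiableAt hu]
    with y hy huy
  have hleft := (extChartAt I x).left_inv hy
  rw [comp_apply, fderiv_comp_extChartAt_symm_chartField ((extChartAt I x).map_source hy)
    (hleft.symm ▸ huy), hleft]

theorem modelDeriv_mlieBracket {x : N} {u : N → F} (hu : CMDiffAt ∞ u x)
    {V W : ∀ y : N, TangentSpace I y} (hV : MDiffAt (T% V) x) (hW : MDiffAt (T% W) x) :
    modelDeriv I 𝓘(ℝ, F) u x (VectorField.mlieBracket I V W x) =
      modelDeriv I 𝓘(ℝ, F) (fun y => modelDeriv I 𝓘(ℝ, F) u y (W y)) x (V x) -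
        modelDeriv I 𝓘(ℝ, F) (fun y => modelDeriv I 𝓘(ℝ, F) u y (V y)) x (W x) := by
  rw [← fderiv_comp_extChartAt_symm_chartField_self (hu.mdifferentiableAt (by simp)),
    chartField_mlieBracket hV hW, VectorField.fderiv_apply_lieBracket
      (contDiffAt_comp_extChartAt_symm hu) (by simpa using ENat.LEInfty.out)
      (differentiableAt_chartField hW) (differentiableAt_chartField hV),
    (fderiv_comp_extChartAt_symm_chartField_eventuallyEq hu W).fderiv_eq,
    (fderiv_comp_extChartAt_symm_chartField_eventuallyEq hu V).fderiv_eq,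
    fderiv_comp_extChartAt_symm_chartField_self (mdifferentiableAt_modelDeriv_apply hu hW),
    fderiv_comp_extChartAt_symm_chartField_self (mdifferentiableAt_modelDeriv_apply hu hV)]

end LieBracket

section Curvature

variable {E H : Type*} [NormedAddCommGroup E] [NormedSpace ℝ E]
  [TopologicalSpace H] {I : ModelWithCorners ℝ E H} {N : Type*} [TopologicalSpace N]
  [ChartedSpace H N] [IsManifold I ∞ N]

theorem exists_mdifferentiableAt_apply_eq [FiniteDimensional ℝ E] (x : N)
    (v : TangentSpace I x) : ∃ X : ∀ y : N, TangentSpace I y, MDiffAt (T% X) x ∧ X x = v :=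
  ⟨FiberBundle.extend E v, FiberBundle.mdifferentiableAt_extend I E v,
    FiberBundle.extend_apply_self E v⟩

namespace VectorForm

theorem ext {k : ℕ} {R R' : VectorForm I N k}
    (h : ∀ (x : N) (v : Fin k → TangentSpace I x), R x v = R' x v) : R = R' := by
  cases R; cases R'
  congr 1
  funext x
  exact ContinuousAlternatingMap.ext (h x)

instance (k : ℕ) : Zero (VectorForm I N k) where
  zero :=
    { toFun := fun _ => 0
      smooth' := fun _ _ _ _ =>
        (contMDiff_zeroSection ℝ (TangentSpace I : N → Type _)).contMDiffOn }

/-- The endomorphism of the tangent space at `x` given by a vector-valued one-form. -/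
def endo (K : VectorForm I N 1) (x : N) : TangentSpace I x →L[ℝ] TangentSpace I x :=
  (ContinuousAlternatingMap.ofSubsingleton ℝ _ _ (0 : Fin 1)).symm (K x)

/-- The endomorphism `Id - K` of the tangent space at `x`. -/
def compl (K : VectorForm I N 1) (x : N) : TangentSpace I x →L[ℝ] TangentSpace I x :=
  .id ℝ _ - K.endo x

theorem compl_apply (K : VectorForm I N 1) (x : N) (v : TangentSpace I x) :
    K.compl x v = v - K.endo x v := rfl

theorem compl_eq_self {K : VectorForm I N 1} {x : N} {v : TangentSpace I x}
    (h : K.endo x v = 0) : K.compl x v = v := by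
  rw [compl_apply, h, sub_zero]

theorem smoothFieldOn_endo (K : VectorForm I N 1) {U : Set N} (hU : IsOpen U)
    {X : ∀ x : N, TangentSpace I x} (hX : SmoothFieldOn I N X U) :
    SmoothFieldOn I N (fun x => K.endo x (X x)) U :=
  K.smooth' U hU (fun _ => X) fun _ => hX

theorem smoothFieldOn_compl (K : VectorForm I N 1) {U : Set N} (hU : IsOpen U)
    {X : ∀ x : N, TangentSpace I x} (hX : SmoothFieldOn I N X U) :
    SmoothFieldOn I N (fun x => K.compl x (X x)) U :=
  ContMDiffOn.sub_section hX (K.smoothFieldOn_endo hU hX)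

/-- The curvature of `K`, as an operation on vector fields. -/
def curvatureOp (K : VectorForm I N 1) (x : N) (X Y : ∀ x : N, TangentSpace I x) :
    TangentSpace I x :=
  K.endo x (VectorField.mlieBracket I (fun y => K.compl y (X y)) (fun y => K.compl y (Y y)) x)

theorem curvatureOp_swap (K : VectorForm I N 1) (x : N) (X Y : ∀ x : N, TangentSpace I x) :
    K.curvatureOp x X Y = - K.curvatureOp x Y X := by
  rw [curvatureOp, VectorField.mlieBracket_swap_apply, map_neg]
  rfl

/-- The one-form `K` is a field of projections of the tangent spaces. -/
def IsProjection (K : VectorForm I N 1) : Prop := ∀ x v, K.endo x (K.endo x v) = K.endo x v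

theorem IsProjection.endo_compl {K : VectorForm I N 1} (hK : K.IsProjection) (x : N)
    (v : TangentSpace I x) : K.endo x (K.compl x v) = 0 := by
  rw [compl_apply, map_sub, hK, sub_self]

theorem IsProjection.compl_endo {K : VectorForm I N 1} (hK : K.IsProjection) (x : N)
    (v : TangentSpace I x) : K.compl x (K.endo x v) = 0 := by
  rw [compl_apply, hK, sub_self]

variable [FiniteDimensional ℝ E]

theorem mdifferentiableAt_endo (K : VectorForm I N 1) {x : N}
    {X : ∀ x : N, TangentSpace I x} (hX : MDiffAt (T% X) x) :
    MDiffAt (T% (fun y => K.endo y (X y))) x := by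
  let t := trivializationAt E (TangentSpace I : N → Type _) x
  have hx : x ∈ t.baseSet := FiberBundle.mem_baseSet_trivializationAt E (TangentSpace I) x
  let b := Module.Basis.ofVectorSpace ℝ E
  have hframe (i) : MDiffAt (T% (fun y => K.endo y (t.localFrame b i y))) x :=
    ((K.smoothFieldOn_endo t.open_baseSet (t.contMDiffOn_localFrame_baseSet ∞ b i)).contMDiffAt
      (t.open_baseSet.mem_nhds hx)).mdifferentiableAt (by simp)
  have hsum := MDifferentiableAt.sum_section (s := Finset.univ)
    fun i _ => (mdifferentiableAt_localFrameCoeff (I := I) b hx hX i).smul_section (hframe i)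
  refine hsum.congr_of_eventuallyEq ?_
  filter_upwards [t.eventually_eq_localFrame_sum_coeff_smul (I := I) b hx] with y hy
  have hKy : K.endo y (X y) =
      ∑ i, t.localFrameCoeff I b i y (X y) • K.endo y (t.localFrame b i y) := by
    simpa only [map_sum, map_smul] using congrArg (K.endo y) hy
  simp only [hKy, Pi.smul_apply', LinearMap.piApply_apply]

theorem mdifferentiableAt_compl (K : VectorForm I N 1) {x : N} {X : ∀ x : N, TangentSpace I x}
    (hX : MDiffAt (T% X) x) :
    MDiffAt (T% (fun y => K.compl y (X y))) x :=
  mdifferentiableAt_sub_section hX (K.mdifferentiableAt_endo hX)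

theorem tensorialAt_curvatureOp_left {K : VectorForm I N 1} (hK : K.IsProjection)
    (x : N) (Y : ∀ x : N, TangentSpace I x) :
    TensorialAt I E (fun X => K.curvatureOp x X Y) x := by
  constructor
  · intro f X hf hX
    have hsmul : (fun y => K.compl y ((f • X) y)) = f • fun y => K.compl y (X y) := by
      funext y
      exact map_smul (K.compl y) (f y) (X y)
    rw [curvatureOp, hsmul, VectorField.mlieBracket_smul_left hf (K.mdifferentiableAt_compl hX),
      map_add, map_smul, map_smul, hK.endo_compl, smul_zero, zero_add]
    rfl
  · intro X X' hX hX'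
    have hadd : (fun y => K.compl y ((X + X') y)) =
        (fun y => K.compl y (X y)) + fun y => K.compl y (X' y) := by
      funext y
      exact map_add (K.compl y) (X y) (X' y)
    rw [curvatureOp, hadd, VectorField.mlieBracket_add_left (K.mdifferentiableAt_compl hX)
      (K.mdifferentiableAt_compl hX'), map_add]
    rfl

theorem tensorialAt_curvatureOp_right {K : VectorForm I N 1} (hK : K.IsProjection)
    (x : N) (X : ∀ x : N, TangentSpace I x) :
    TensorialAt I E (K.curvatureOp x X) x := by
  have hleft := tensorialAt_curvatureOp_left hK x X
  constructor
  · intro f Y hf hY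
    rw [curvatureOp_swap, hleft.smul hf hY, ← smul_neg, ← curvatureOp_swap]
  · intro Y Y' hY hY'
    rw [curvatureOp_swap, hleft.add hY hY', neg_add, ← curvatureOp_swap, ← curvatureOp_swap]

/-- The curvature of `K` at `x`, as a bilinear map. -/
def curvatureBilin {K : VectorForm I N 1} (hK : K.IsProjection) (x : N) :
    TangentSpace I x →L[ℝ] TangentSpace I x →L[ℝ] TangentSpace I x :=
  TensorialAt.mkHom₂ (I := I) (F := E) (F' := E) (K.curvatureOp x) x
    (fun Y _ => tensorialAt_curvatureOp_left hK x Y)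
    (fun X _ => tensorialAt_curvatureOp_right hK x X)

theorem curvatureBilin_apply {K : VectorForm I N 1} (hK : K.IsProjection)
    {x : N} {X Y : ∀ x : N, TangentSpace I x}
    (hX : MDiffAt (T% X) x) (hY : MDiffAt (T% Y) x) :
    curvatureBilin hK x (X x) (Y x) = K.curvatureOp x X Y :=
  TensorialAt.mkHom₂_apply (I := I) (F := E) (F' := E)
    (fun Y _ => tensorialAt_curvatureOp_left hK x Y)
    (fun X _ => tensorialAt_curvatureOp_right hK x X) hX hY

theorem curvatureBilin_self {K : VectorForm I N 1} (hK : K.IsProjection)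
    (x : N) (v : TangentSpace I x) :
    curvatureBilin hK x v v = 0 := by
  have happly := curvatureBilin_apply hK (FiberBundle.mdifferentiableAt_extend I E v)
    (FiberBundle.mdifferentiableAt_extend I E v)
  rw [FiberBundle.extend_apply_self, curvatureOp, VectorField.mlieBracket_self] at happly
  exact happly.trans (map_zero _)

/-- The curvature of a projection `K`, as a vector-valued two-form. -/
def curvature {K : VectorForm I N 1} (hK : K.IsProjection) : VectorForm I N 2 where
  toFun x :=
    { toFun := fun v => curvatureBilin hK x (v 0) (v 1)
      map_update_add' := by
        intro _ _ i _ _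
        fin_cases i <;> simp
      map_update_smul' := by
        intro _ _ i _ _
        fin_cases i <;> simp
      cont := by fun_prop
      map_eq_zero_of_eq' := by
        intro v i j hij hne
        have heq : v 0 = v 1 := by
          fin_cases i <;> fin_cases j <;> first | exact absurd rfl hne | exact hij | exact hij.symm
        simpa only [heq] using curvatureBilin_self hK x (v 1) }
  smooth' := by
    intro U hU X hX
    have : IsManifold I (minSmoothness ℝ 2) N := by
      rw [minSmoothness_of_isRCLikeNormedField]; infer_instance
    have : IsManifold I (((⊤ : ℕ∞) : WithTop ℕ∞) + 1) N := inferInstanceAs (IsManifold I ∞ N)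
    have hsmooth (i : Fin 2) {x : N} (hx : x ∈ U) : CMDiffAt ∞ (T% (X i)) x :=
      (hX i).contMDiffAt (hU.mem_nhds hx)
    have hbracket : SmoothFieldOn I N (fun x => VectorField.mlieBracket I
        (fun y => K.compl y (X 0 y)) (fun y => K.compl y (X 1 y)) x) U := fun x hx =>
      (ContMDiffAt.mlieBracket_vectorField (m := ⊤) (n := ⊤)
        ((K.smoothFieldOn_compl hU (hX 0)).contMDiffAt (hU.mem_nhds hx))
        ((K.smoothFieldOn_compl hU (hX 1)).contMDiffAt (hU.mem_nhds hx))
        (by rw [minSmoothness_of_isRCLikeNormedField]; rfl)).contMDiffWithinAt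
    refine (K.smoothFieldOn_endo hU hbracket).congr fun x hx => ?_
    exact congrArg (fun v : TangentSpace I x => (⟨x, v⟩ : TangentBundle I N))
      (curvatureBilin_apply hK ((hsmooth 0 hx).mdifferentiableAt (by simp))
        ((hsmooth 1 hx).mdifferentiableAt (by simp)))

theorem isCurvature_curvature {K : VectorForm I N 1} (hK : K.IsProjection) :
    IsCurvature K (curvature hK) := by
  intro X Y hX hY x
  exact curvatureBilin_apply hK
    ((hX.contMDiffAt Filter.univ_mem).mdifferentiableAt (by simp))
    ((hY.contMDiffAt Filter.univ_mem).mdifferentiableAt (by simp))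

theorem curvatureBilin_endo_left {K : VectorForm I N 1} (hK : K.IsProjection)
    (x : N) (v w : TangentSpace I x) :
    curvatureBilin hK x (K.endo x v) w = 0 := by
  have happly := curvatureBilin_apply hK
    (K.mdifferentiableAt_endo (FiberBundle.mdifferentiableAt_extend I E v))
    (FiberBundle.mdifferentiableAt_extend I E w)
  have hzero : (fun y => K.compl y (K.endo y (FiberBundle.extend E v y))) = 0 :=
    funext fun y => hK.compl_endo y _
  rw [FiberBundle.extend_apply_self, FiberBundle.extend_apply_self, curvatureOp, hzero,
    VectorField.mlieBracket_zero_left] at happly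
  exact happly.trans (map_zero _)

theorem curvatureBilin_endo_right {K : VectorForm I N 1} (hK : K.IsProjection)
    (x : N) (v w : TangentSpace I x) :
    curvatureBilin hK x v (K.endo x w) = 0 := by
  have hself := curvatureBilin_self hK x (v + K.endo x w)
  simpa [curvatureBilin_self, curvatureBilin_endo_left] using hself

theorem curvatureBilin_compl {K : VectorForm I N 1} (hK : K.IsProjection)
    (x : N) (v w : TangentSpace I x) :
    curvatureBilin hK x (K.compl x v) (K.compl x w) = curvatureBilin hK x v w := by
  simp [compl_apply, curvatureBilin_endo_left, curvatureBilin_endo_right]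

variable [T2Space N]

theorem exists_smoothField_apply_eq (x : N) (v : TangentSpace I x) :
    ∃ X : ∀ x : N, TangentSpace I x, SmoothFieldOn I N X univ ∧ X x = v := by
  obtain ⟨U, hU, hextend⟩ := FiberBundle.exists_contMDiffOn_extend (k := ∞) I E v
  obtain ⟨f, -, hf⟩ := (SmoothBumpFunction.nhds_basis_tsupport (I := I) x).mem_iff.1
    (interior_mem_nhds.2 hU)
  refine ⟨fun y => f y • FiberBundle.extend E v y, ?_, ?_⟩
  · exact (ContMDiffOn.smul_section_of_tsupport f.contMDiff.contMDiffOn isOpen_interior hf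
      (hextend.mono interior_subset)).contMDiffOn
  · simp

end VectorForm

theorem IsCurvature.unique [FiniteDimensional ℝ E] [T2Space N] {K : VectorForm I N 1}
    {R R' : VectorForm I N 2} (h : IsCurvature K R) (h' : IsCurvature K R') : R = R' := by
  refine VectorForm.ext fun x v => ?_
  obtain ⟨X, hX, hXv⟩ := VectorForm.exists_smoothField_apply_eq x (v 0)
  obtain ⟨Y, hY, hYv⟩ := VectorForm.exists_smoothField_apply_eq x (v 1)
  have hv : v = ![X x, Y x] := by
    rw [hXv, hYv]
    exact (FinVec.etaExpand_eq v).symm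
  rw [hv, h X Y hX hY, h' X Y hX hY]

end Curvature

section AlongMap

variable {E H E' H' : Type*} [NormedAddCommGroup E] [NormedSpace ℝ E] [TopologicalSpace H]
  [NormedAddCommGroup E'] [NormedSpace ℝ E'] [TopologicalSpace H']
  {I : ModelWithCorners ℝ E H} {I' : ModelWithCorners ℝ E' H'}
  {N N' : Type*} [TopologicalSpace N] [ChartedSpace H N] [IsManifold I ∞ N]
  [TopologicalSpace N'] [ChartedSpace H' N'] [IsManifold I' ∞ N']

namespace VectorForm

/-- The matrix of the endomorphism `K` at `y` in the chart around `x`. -/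
def endoInChart (K : VectorForm I' N' 1) (x y : N') : E' →L[ℝ] E' :=
  (trivializationAt E' (TangentSpace I') x).continuousLinearMapAt ℝ y ∘L K.endo y ∘L
    (trivializationAt E' (TangentSpace I') x).symmL ℝ y

theorem modelDeriv_extChartAt_endo (K : VectorForm I' N' 1) {x y : N'}
    (hy : y ∈ (chartAt H' x).source) (v : E') :
    modelDeriv I' 𝓘(ℝ, E') (extChartAt I' x) y (K.endo y v) =
      K.endoInChart x y (modelDeriv I' 𝓘(ℝ, E') (extChartAt I' x) y v) := by
  have hbase : y ∈ (trivializationAt E' (TangentSpace I') x).baseSet := by simpa using hy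
  have hderiv : modelDeriv I' 𝓘(ℝ, E') (extChartAt I' x) y =
      (trivializationAt E' (TangentSpace I') x).continuousLinearMapAt ℝ y :=
    (TangentBundle.continuousLinearMapAt_trivializationAt hy).symm
  rw [hderiv, endoInChart]
  exact congrArg (fun w => (trivializationAt E' (TangentSpace I') x).continuousLinearMapAt ℝ y
    (K.endo y w)) (Trivialization.symmL_continuousLinearMapAt _ hbase v).symm

theorem modelDeriv_extChartAt_compl (K : VectorForm I' N' 1) {x y : N'}
    (hy : y ∈ (chartAt H' x).source) (v : E') :
    modelDeriv I' 𝓘(ℝ, E') (extChartAt I' x) y (K.compl y v) =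
      modelDeriv I' 𝓘(ℝ, E') (extChartAt I' x) y v -
        K.endoInChart x y (modelDeriv I' 𝓘(ℝ, E') (extChartAt I' x) y v) := by
  rw [← modelDeriv_extChartAt_endo K hy]
  exact map_sub (modelDeriv I' 𝓘(ℝ, E') (extChartAt I' x) y) v (K.endo y v)

theorem IsProjection.endoInChart_endoInChart {K : VectorForm I' N' 1} (hK : K.IsProjection)
    {x y : N'} (hy : y ∈ (chartAt H' x).source) (v : E') :
    K.endoInChart x y (K.endoInChart x y v) = K.endoInChart x y v := by
  have hbase : y ∈ (trivializationAt E' (TangentSpace I') x).baseSet := by simpa using hy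
  simp only [endoInChart, ContinuousLinearMap.comp_apply]
  rw [Trivialization.symmL_continuousLinearMapAt _ hbase, hK]

variable [FiniteDimensional ℝ E']

theorem continuousAt_endoInChart (K : VectorForm I' N' 1) (x : N') :
    ContinuousAt (K.endoInChart x) x := by
  set t := trivializationAt E' (TangentSpace I') x
  have hx : x ∈ t.baseSet := FiberBundle.mem_baseSet_trivializationAt E' (TangentSpace I') x
  refine continuousAt_clm_apply.2 fun v => ?_
  have hfield := (mdifferentiableAt_section I' _).1 (K.mdifferentiableAt_endo
    (FiberBundle.mdifferentiableAt_extend I' E' (t.symmL ℝ x v)))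
  refine hfield.continuousAt.congr ?_
  filter_upwards [t.open_baseSet.mem_nhds hx] with y hy
  have hextend : FiberBundle.extend E' (t.symmL ℝ x v) y = t.symmL ℝ y v := by
    rw [Trivialization.symmL_apply _ hx, Trivialization.symmL_apply _ hy]
    exact congrArg (t.symm y) (congrArg Prod.snd (t.apply_mk_symm hx v))
  simp only [hextend, endoInChart, ContinuousLinearMap.comp_apply,
    Trivialization.continuousLinearMapAt_apply, Trivialization.coe_linearMapAt_of_mem t hy, t]

variable [I.Boundaryless] [I'.Boundaryless] [CompleteSpace E]

/-- Only the value of `X'` at `f x` matters, so the defect of `X` and `X'` being `f`-related may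
have a nonzero derivative; that derivative takes values in the kernel of the projection `K`. -/
theorem endoInChart_modelDeriv_sub_eq_zero {K : VectorForm I' N' 1} (hK : K.IsProjection)
    {f : N → N'} {x : N} (hf : CMDiffAt ∞ f x) {X : ∀ y : N, TangentSpace I y}
    {X' : ∀ y : N', TangentSpace I' y} (hX : MDiffAt (T% X) x) (hX' : MDiffAt (T% X') (f x))
    (hKX : ∀ᶠ y in 𝓝 x, K.endo (f y) (modelDeriv I I' f y (X y)) = 0)
    (hXX' : X' (f x) = modelDeriv I I' f x (X x)) (v : E) :
    K.endoInChart (f x) (f x) (modelDeriv I 𝓘(ℝ, E')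
      (fun y => modelDeriv I 𝓘(ℝ, E') (fun z => extChartAt I' (f x) (f z)) y (X y) -
        modelDeriv I' 𝓘(ℝ, E') (extChartAt I' (f x)) (f y) (K.compl (f y) (X' (f y)))) x v) =
      0 := by
  set u := extChartAt I' (f x)
  have hu : CMDiffAt ∞ u (f x) := contMDiffAt_extChartAt
  have hf1 : MDiffAt f x := hf.mdifferentiableAt (by simp)
  have hchain : ∀ᶠ y in 𝓝 x, modelDeriv I 𝓘(ℝ, E') (fun z => u (f z)) y (X y) =
      modelDeriv I' 𝓘(ℝ, E') u (f y) (modelDeriv I I' f y (X y)) := by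
    filter_upwards [eventually_mdifferentiableAt hf,
      hf.continuousAt.eventually (eventually_mdifferentiableAt hu)] with y hfy huy
      using modelDeriv_comp huy hfy _
  set ξ : N → E' := fun y => modelDeriv I 𝓘(ℝ, E') (fun z => u (f z)) y (X y) -
    modelDeriv I' 𝓘(ℝ, E') u (f y) (X' (f y))
  have hξ : MDiffAt ξ x := (mdifferentiableAt_modelDeriv_apply (hu.comp x hf) hX).sub
    ((mdifferentiableAt_modelDeriv_apply hu hX').comp x hf1)
  have hξx : ξ x = 0 := by simp only [ξ, hchain.self_of_nhds, hXX', sub_self]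
  have hfactor : (fun y => modelDeriv I 𝓘(ℝ, E') (fun z => u (f z)) y (X y) -
      modelDeriv I' 𝓘(ℝ, E') u (f y) (K.compl (f y) (X' (f y)))) =ᶠ[𝓝 x]
        fun y => (ContinuousLinearMap.id ℝ E' - K.endoInChart (f x) (f y)) (ξ y) := by
    filter_upwards [hchain, hKX, hf.continuousAt.eventually_mem
      (chart_source_mem_nhds H' (f x))] with y hchain hKX hy
    have hAX : K.endoInChart (f x) (f y)
        (modelDeriv I' 𝓘(ℝ, E') u (f y) (modelDeriv I I' f y (X y))) = 0 := by
      rw [← modelDeriv_extChartAt_endo K hy]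
      exact (congrArg _ hKX).trans (map_zero _)
    simp only [ξ, hchain, sub_apply, ContinuousLinearMap.id_apply, map_sub, hAX, sub_zero]
    refine (congrArg _ (modelDeriv_extChartAt_compl K hy _)).trans ?_
    abel
  have hcont : ContinuousAt (fun y => ContinuousLinearMap.id ℝ E' - K.endoInChart (f x) (f y)) x :=
    continuousAt_const.sub ((K.continuousAt_endoInChart (f x)).comp hf1.continuousAt)
  rw [modelDeriv_congr hfactor, modelDeriv_clm_apply_of_eq_zero hcont hξ hξx,
    sub_apply, map_sub, ContinuousLinearMap.id_apply,
    hK.endoInChart_endoInChart (mem_chart_source H' (f x)), sub_self]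

theorem endoInChart_modelDeriv_eq {K : VectorForm I' N' 1} (hK : K.IsProjection)
    {f : N → N'} {x : N} (hf : CMDiffAt ∞ f x) {X : ∀ y : N, TangentSpace I y}
    {X' : ∀ y : N', TangentSpace I' y} (hX : MDiffAt (T% X) x) (hX' : MDiffAt (T% X') (f x))
    (hKX : ∀ᶠ y in 𝓝 x, K.endo (f y) (modelDeriv I I' f y (X y)) = 0)
    (hXX' : X' (f x) = modelDeriv I I' f x (X x)) (v : E) :
    K.endoInChart (f x) (f x) (modelDeriv I 𝓘(ℝ, E')
      (fun y => modelDeriv I 𝓘(ℝ, E') (fun z => extChartAt I' (f x) (f z)) y (X y)) x v) =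
    K.endoInChart (f x) (f x) (modelDeriv I' 𝓘(ℝ, E')
      (fun z => modelDeriv I' 𝓘(ℝ, E') (extChartAt I' (f x)) z (K.compl z (X' z))) (f x)
        (modelDeriv I I' f x v)) := by
  have hf1 : MDiffAt f x := hf.mdifferentiableAt (by simp)
  have hu : CMDiffAt ∞ (extChartAt I' (f x)) (f x) := contMDiffAt_extChartAt
  have ha := mdifferentiableAt_modelDeriv_apply (u := fun z => extChartAt I' (f x) (f z))
    (hu.comp x hf) hX
  have hb := mdifferentiableAt_modelDeriv_apply hu (K.mdifferentiableAt_compl hX')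
  rw [← modelDeriv_comp hb hf1]
  refine sub_eq_zero.1 ((map_sub _ _ _).symm.trans ?_)
  exact (congrArg _ (modelDeriv_sub ha (hb.comp x hf1) v).symm).trans
    (endoInChart_modelDeriv_sub_eq_zero hK hf hX hX' hKX hXX' v)

theorem endo_modelDeriv_mlieBracket_eq_curvatureOp {K : VectorForm I' N' 1} (hK : K.IsProjection)
    {f : N → N'} {x : N} (hf : CMDiffAt ∞ f x) {X Y : ∀ y : N, TangentSpace I y}
    {X' Y' : ∀ y : N', TangentSpace I' y} (hX : MDiffAt (T% X) x) (hY : MDiffAt (T% Y) x)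
    (hX' : MDiffAt (T% X') (f x)) (hY' : MDiffAt (T% Y') (f x))
    (hKX : ∀ᶠ y in 𝓝 x, K.endo (f y) (modelDeriv I I' f y (X y)) = 0)
    (hKY : ∀ᶠ y in 𝓝 x, K.endo (f y) (modelDeriv I I' f y (Y y)) = 0)
    (hXX' : X' (f x) = modelDeriv I I' f x (X x)) (hYY' : Y' (f x) = modelDeriv I I' f x (Y x)) :
    K.endo (f x) (modelDeriv I I' f x (VectorField.mlieBracket I X Y x)) =
      K.curvatureOp (f x) X' Y' := by
  have hf1 : MDiffAt f x := hf.mdifferentiableAt (by simp)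
  let u := extChartAt I' (f x)
  let A := K.endoInChart (f x) (f x)
  have hu : CMDiffAt ∞ u (f x) := contMDiffAt_extChartAt
  let a (Z : ∀ y : N, TangentSpace I y) (y : N) : E' :=
    modelDeriv I 𝓘(ℝ, E') (fun z => u (f z)) y (Z y)
  let b (Z : ∀ y : N', TangentSpace I' y) (y : N') : E' :=
    modelDeriv I' 𝓘(ℝ, E') u y (K.compl y (Z y))
  have hcompl {Z : ∀ y : N, TangentSpace I y} {Z' : ∀ y : N', TangentSpace I' y}
      (hKZ : ∀ᶠ y in 𝓝 x, K.endo (f y) (modelDeriv I I' f y (Z y)) = 0)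
      (hZZ' : Z' (f x) = modelDeriv I I' f x (Z x)) :
      modelDeriv I I' f x (Z x) = K.compl (f x) (Z' (f x)) :=
    ((congrArg (K.compl (f x)) hZZ').trans (compl_eq_self hKZ.self_of_nhds)).symm
  have hchart : A (modelDeriv I' 𝓘(ℝ, E') u (f x)
      (modelDeriv I I' f x (VectorField.mlieBracket I X Y x))) =
        A (modelDeriv I' 𝓘(ℝ, E') u (f x) (VectorField.mlieBracket I'
          (fun y => K.compl y (X' y)) (fun y => K.compl y (Y' y)) (f x))) :=
    calc
      _ = A (modelDeriv I 𝓘(ℝ, E') (fun z => u (f z)) x (VectorField.mlieBracket I X Y x)) :=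
        congrArg A (modelDeriv_comp (hu.mdifferentiableAt (by simp)) hf1 _).symm
      _ = A (modelDeriv I 𝓘(ℝ, E') (a Y) x (X x)) - A (modelDeriv I 𝓘(ℝ, E') (a X) x (Y x)) :=
        (congrArg A (modelDeriv_mlieBracket (hu.comp x hf) hX hY)).trans (map_sub _ _ _)
      _ = A (modelDeriv I' 𝓘(ℝ, E') (b Y') (f x) (K.compl (f x) (X' (f x)))) -
            A (modelDeriv I' 𝓘(ℝ, E') (b X') (f x) (K.compl (f x) (Y' (f x)))) :=
        congrArg₂ (· - ·)
          ((endoInChart_modelDeriv_eq hK hf hY hY' hKY hYY' _).trans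
            (congrArg (fun v => A (modelDeriv I' 𝓘(ℝ, E') (b Y') (f x) v)) (hcompl hKX hXX')))
          ((endoInChart_modelDeriv_eq hK hf hX hX' hKX hXX' _).trans
            (congrArg (fun v => A (modelDeriv I' 𝓘(ℝ, E') (b X') (f x) v)) (hcompl hKY hYY')))
      _ = _ := ((congrArg A (modelDeriv_mlieBracket hu (K.mdifferentiableAt_compl hX')
        (K.mdifferentiableAt_compl hY'))).trans (map_sub _ _ _)).symm
  have hx := mem_chart_source H' (f x)
  exact (isInvertible_mfderiv_extChartAt (mem_extChartAt_source (f x))).injective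
    ((modelDeriv_extChartAt_endo K hx _).trans
      (hchart.trans (modelDeriv_extChartAt_endo K hx _).symm))

theorem endo_modelDeriv_mlieBracket {K : VectorForm I' N' 1} (hK : K.IsProjection)
    {f : N → N'} {x : N} (hf : CMDiffAt ∞ f x) {X Y : ∀ y : N, TangentSpace I y}
    (hX : MDiffAt (T% X) x) (hY : MDiffAt (T% Y) x)
    (hKX : ∀ᶠ y in 𝓝 x, K.endo (f y) (modelDeriv I I' f y (X y)) = 0)
    (hKY : ∀ᶠ y in 𝓝 x, K.endo (f y) (modelDeriv I I' f y (Y y)) = 0) :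
    K.endo (f x) (modelDeriv I I' f x (VectorField.mlieBracket I X Y x)) =
      curvatureBilin hK (f x) (modelDeriv I I' f x (X x)) (modelDeriv I I' f x (Y x)) := by
  obtain ⟨X', hX', hXX'⟩ := exists_mdifferentiableAt_apply_eq (I := I') (f x)
    (modelDeriv I I' f x (X x))
  obtain ⟨Y', hY', hYY'⟩ := exists_mdifferentiableAt_apply_eq (I := I') (f x)
    (modelDeriv I I' f x (Y x))
  rw [← hXX', ← hYY', curvatureBilin_apply hK hX' hY']
  exact endo_modelDeriv_mlieBracket_eq_curvatureOp hK hf hX hY hX' hY' hKX hKY hXX' hYY'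

end VectorForm

end AlongMap

section Related

variable {E E' H H' N N' : Type*}
  [NormedAddCommGroup E] [NormedSpace ℝ E] [TopologicalSpace H] {I : ModelWithCorners ℝ E H}
  [NormedAddCommGroup E'] [NormedSpace ℝ E'] [TopologicalSpace H'] {I' : ModelWithCorners ℝ E' H'}
  [TopologicalSpace N] [ChartedSpace H N] [IsManifold I ∞ N]
  [TopologicalSpace N'] [ChartedSpace H' N'] [IsManifold I' ∞ N'] {k : ℕ} {f : N → N'}

namespace VectorForm

theorem apply_congr_base (R : VectorForm I N k) {x y : N} (h : x = y) (v : Fin k → E) :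
    (R x v : E) = R y v := by
  subst h
  rfl

/-- The vector-valued forms `R` and `R'` are `f`-related: `Tf` intertwines them. -/
def IsRelated (f : N → N') (R : VectorForm I N k) (R' : VectorForm I' N' k) : Prop :=
  ∀ (x : N) (v : Fin k → E),
    modelDeriv I I' f x (R x v) = R' (f x) fun i => modelDeriv I I' f x (v i)

theorem IsRelated.modelDeriv_endo {K : VectorForm I N 1} {K' : VectorForm I' N' 1}
    (h : IsRelated f K K') (x : N) (v : E) :
    modelDeriv I I' f x (K.endo x v) = K'.endo (f x) (modelDeriv I I' f x v) :=
  h x fun _ => v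

theorem IsRelated.modelDeriv_compl {K : VectorForm I N 1} {K' : VectorForm I' N' 1}
    (h : IsRelated f K K') (x : N) (v : E) :
    modelDeriv I I' f x (K.compl x v) = K'.compl (f x) (modelDeriv I I' f x v) :=
  (map_sub (modelDeriv I I' f x) v (K.endo x v)).trans
    (congrArg (modelDeriv I I' f x v - ·) (h.modelDeriv_endo x v))

theorem IsRelated.isProjection {K : VectorForm I N 1} {K' : VectorForm I' N' 1}
    (h : IsRelated f K K') (hf : Surjective f) (hf' : ∀ x, Surjective (modelDeriv I I' f x))
    (hK : K.IsProjection) : K'.IsProjection := by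
  intro y w
  obtain ⟨x, rfl⟩ := hf y
  obtain ⟨v, rfl⟩ := hf' x w
  exact (congrArg (K'.endo (f x)) (h.modelDeriv_endo x v).symm).trans
    ((h.modelDeriv_endo x _).symm.trans
      ((congrArg (modelDeriv I I' f x) (hK x v)).trans (h.modelDeriv_endo x v)))

theorem IsRelated.curvature [FiniteDimensional ℝ E] [FiniteDimensional ℝ E'] [I.Boundaryless]
    [I'.Boundaryless] {K : VectorForm I N 1} {K' : VectorForm I' N' 1} (h : IsRelated f K K')
    (hf : CMDiff ∞ f) (hK : K.IsProjection) (hK' : K'.IsProjection) :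
    IsRelated f (curvature hK) (curvature hK') := by
  have : CompleteSpace E := FiniteDimensional.complete ℝ E
  intro x v
  obtain ⟨X, hX, hXv⟩ := exists_mdifferentiableAt_apply_eq (I := I) x (v 0)
  obtain ⟨Y, hY, hYv⟩ := exists_mdifferentiableAt_apply_eq (I := I) x (v 1)
  have hzero (Z : ∀ y : N, TangentSpace I y) :
      ∀ᶠ y in 𝓝 x, K'.endo (f y) (modelDeriv I I' f y (K.compl y (Z y))) = 0 :=
    .of_forall fun y => (congrArg (K'.endo (f y)) (h.modelDeriv_compl y (Z y))).trans
      (hK'.endo_compl _ _)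
  have hcompl (Z : ∀ y : N, TangentSpace I y) := h.modelDeriv_compl x (Z x)
  have hcurvature : K.curvatureOp x X Y = curvatureBilin hK x (v 0) (v 1) := by
    rw [← hXv, ← hYv, curvatureBilin_apply hK hX hY]
  have hbracket : modelDeriv I I' f x (K.curvatureOp x X Y) =
      curvatureBilin hK' (f x) (K'.compl (f x) (modelDeriv I I' f x (v 0)))
        (K'.compl (f x) (modelDeriv I I' f x (v 1))) := by
    rw [← hXv, ← hYv]
    exact (h.modelDeriv_endo x _).trans ((endo_modelDeriv_mlieBracket hK' (hf x)
      (K.mdifferentiableAt_compl hX) (K.mdifferentiableAt_compl hY) (hzero X) (hzero Y)).trans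
      (congrArg₂ (fun u w => curvatureBilin hK' (f x) u w) (hcompl X) (hcompl Y)))
  exact (congrArg (modelDeriv I I' f x) hcurvature.symm).trans
    (hbracket.trans (curvatureBilin_compl hK' _ _ _))

end VectorForm

theorem mdifferentiableAt_prodField {X : ∀ x : N, TangentSpace I x}
    {Y : ∀ y : N', TangentSpace I' y} {z : N × N'} (hX : MDiffAt (T% X) z.1)
    (hY : MDiffAt (T% Y) z.2) :
    MDifferentiableAt (I.prod I') (I.prod I').tangent
      (fun w => (⟨w, (X w.1, Y w.2)⟩ : TangentBundle (I.prod I') (N × N'))) z :=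
  (contMDiff_equivTangentBundleProd_symm (n := 1)).mdifferentiableAt one_ne_zero |>.comp z
    ((hX.comp z mdifferentiableAt_fst).prodMk (hY.comp z mdifferentiableAt_snd))

end Related

section TangentMul

variable {EA HA EM HM E H A M N : Type*}
  [NormedAddCommGroup EA] [NormedSpace ℝ EA] [TopologicalSpace HA]
  [NormedAddCommGroup EM] [NormedSpace ℝ EM] [TopologicalSpace HM]
  [NormedAddCommGroup E] [NormedSpace ℝ E] [TopologicalSpace H]
  {IA : ModelWithCorners ℝ EA HA} {IM : ModelWithCorners ℝ EM HM} {I : ModelWithCorners ℝ E H}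
  [TopologicalSpace A] [ChartedSpace HA A] [TopologicalSpace M] [ChartedSpace HM M]
  [TopologicalSpace N] [ChartedSpace H N]

namespace LieGroupoid

theorem tangentMul_modelDeriv (𝒢 : LieGroupoid IA IM A M) {f g : N → A} {x : N}
    (hf : MDiffAt f x) (hg : MDiffAt g x) (hfg : ∀ y, 𝒢.src (f y) = 𝒢.tgt (g y)) (v : E) :
    𝒢.tangentMul (f x) (g x) (modelDeriv I IA f x v) (modelDeriv I IA g x v) =
      modelDeriv I IA (fun y => 𝒢.mulExt (f y, g y)) x v := by
  have hmul : MDifferentiableWithinAt (IA.prod IA) IA 𝒢.mulExt 𝒢.composable (f x, g x) :=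
    (𝒢.contMDiffOn_mul _ (hfg x)).mdifferentiableWithinAt (by simp)
  have hmaps : MapsTo (fun y => (f y, g y)) univ 𝒢.composable := fun y _ => hfg y
  have hcomp := (hmul.hasMFDerivWithinAt.comp x
    (hf.prodMk hg).hasMFDerivAt.hasMFDerivWithinAt hmaps).hasMFDerivAt Filter.univ_mem
  exact (congrArg (mfderivWithin (IA.prod IA) IA 𝒢.mulExt 𝒢.composable (f x, g x))
    (modelDeriv_prodMk hf hg v)).symm.trans (DFunLike.congr_fun hcomp.mfderiv v).symm

end LieGroupoid

end TangentMul

section TangentBundle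

variable {E E' H H' N N' : Type*}
  [NormedAddCommGroup E] [NormedSpace ℝ E] [TopologicalSpace H] {I : ModelWithCorners ℝ E H}
  [NormedAddCommGroup E'] [NormedSpace ℝ E'] [TopologicalSpace H'] {I' : ModelWithCorners ℝ E' H'}
  [TopologicalSpace N] [ChartedSpace H N] [TopologicalSpace N'] [ChartedSpace H' N']

theorem tangentBundle_mk_eq_mk {x y : N} (h : x = y) {v w : E} (hvw : v = w) :
    (⟨x, v⟩ : TangentBundle I N) = ⟨y, w⟩ := by
  rw [h, hvw]

theorem contMDiffOn_tangentBundle_mk_const [IsManifold I' ∞ N'] {u : N → E'} {U : Set N}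
    (hu : ContMDiffOn I 𝓘(ℝ, E') ∞ u U) (y : N') :
    ContMDiffOn I I'.tangent ∞ (fun x => (⟨y, u x⟩ : TangentBundle I' N')) U := by
  let t := trivializationAt E' (TangentSpace I') y
  let L : E' →L[ℝ] E' := t.continuousLinearMapAt ℝ y
  have hL (v : E') : (t ⟨y, v⟩).2 = L v := (t.continuousLinearMapAt_apply_of_mem (R := ℝ)
    (FiberBundle.mem_baseSet_trivializationAt E' (TangentSpace I') y) v).symm
  have hLu : ContMDiffOn I 𝓘(ℝ, E') ∞ (fun x => L (u x)) U := L.contMDiff.comp_contMDiffOn hu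
  exact fun x hx => contMDiffWithinAt_totalSpace.2
    ⟨contMDiffWithinAt_const, (hLu x hx).congr (fun z _ => hL (u z)) (hL (u x))⟩

end TangentBundle

section Generators

variable {EM HM EG HG EP HP : Type*}
  [NormedAddCommGroup EM] [NormedSpace ℝ EM] [TopologicalSpace HM]
  [NormedAddCommGroup EG] [NormedSpace ℝ EG] [TopologicalSpace HG]
  [NormedAddCommGroup EP] [NormedSpace ℝ EP] [TopologicalSpace HP]
  {IM : ModelWithCorners ℝ EM HM} {IG : ModelWithCorners ℝ EG HG} {IP : ModelWithCorners ℝ EP HP}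
  {M G P : Type*}
  [TopologicalSpace M] [ChartedSpace HM M] [TopologicalSpace P] [ChartedSpace HP P]
  [TopologicalSpace G] [ChartedSpace HG G] [Group G] [MulAction Gᵐᵒᵖ P]

namespace IsPrincipalTrivialization

variable {B : PrincipalBundle IM IG IP M G P} {e : Trivialization G B.proj} {p : P}

theorem mdifferentiableAt (he : IsPrincipalTrivialization IM IG IP e) (hp : p ∈ e.source) :
    MDifferentiableAt IP (IM.prod IG) e p :=
  ((he.contMDiffOn p hp).contMDiffAt (e.open_source.mem_nhds hp)).mdifferentiableAt (by simp)

theorem mdifferentiableAt_symm (he : IsPrincipalTrivialization IM IG IP e) {y : M × G}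
    (hy : y ∈ e.target) : MDifferentiableAt (IM.prod IG) IP e.toOpenPartialHomeomorph.symm y :=
  ((he.contMDiffOn_symm y hy).contMDiffAt (e.open_target.mem_nhds hy)).mdifferentiableAt (by simp)

theorem symm_proj_mk (he : IsPrincipalTrivialization IM IG IP e) (hp : p ∈ e.source) (h : G) :
    e.toOpenPartialHomeomorph.symm (B.proj p, h) = MulOpposite.op ((e p).2⁻¹ * h) • p := by
  have hact : MulOpposite.op ((e p).2⁻¹ * h) • p ∈ e.source := by
    rwa [e.mem_source, B.proj_act, ← e.mem_source]
  refine (congrArg e.toOpenPartialHomeomorph.symm (Prod.ext ?_ ?_)).trans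
    (e.toOpenPartialHomeomorph.left_inv hact)
  · exact ((e.coe_fst hact).trans (B.proj_act p _)).symm
  · exact ((he.map_act p hp _).trans (mul_inv_cancel_left _ _)).symm

theorem modelDeriv_symm_modelDeriv (he : IsPrincipalTrivialization IM IG IP e)
    (hp : p ∈ e.source) (X : EP) :
    modelDeriv (IM.prod IG) IP e.toOpenPartialHomeomorph.symm (e p)
      (modelDeriv IP (IM.prod IG) e p X) = X := by
  have hleft : (fun q => e.toOpenPartialHomeomorph.symm (e q)) =ᶠ[𝓝 p] fun q => q :=
    Filter.eventuallyEq_of_mem (e.open_source.mem_nhds hp) fun _ hq =>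
      e.toOpenPartialHomeomorph.left_inv hq
  exact (modelDeriv_comp (he.mdifferentiableAt_symm (e.map_source hp))
    (he.mdifferentiableAt hp) X).symm.trans
      ((DFunLike.congr_fun (modelDeriv_congr hleft) X).trans (modelDeriv_id p X))

theorem fst_modelDeriv (he : IsPrincipalTrivialization IM IG IP e) (hp : p ∈ e.source) (X : EP) :
    (modelDeriv IP (IM.prod IG) e p X).1 = modelDeriv IP IM B.proj p X := by
  have hfst : (fun q => (e q).1) =ᶠ[𝓝 p] B.proj :=
    Filter.eventuallyEq_of_mem (e.open_source.mem_nhds hp) fun _ hq => e.coe_fst hq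
  rw [← modelDeriv_congr hfst, ← modelDeriv_fst (I := IM) (I' := IG) (e p)]
  exact (modelDeriv_comp mdifferentiableAt_fst (he.mdifferentiableAt hp) X).symm

end IsPrincipalTrivialization

namespace PrincipalBundle

theorem contMDiff_act_const (B : PrincipalBundle IM IG IP M G P) (g : G) :
    ContMDiff IP IP ∞ fun p : P => MulOpposite.op g • p :=
  B.contMDiff_act.comp (contMDiff_id.prodMk contMDiff_const)

theorem mdifferentiableAt_orbit (B : PrincipalBundle IM IG IP M G P) (p : P) (g : G) :
    MDifferentiableAt IG IP (fun g : G => MulOpposite.op g • p) g :=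
  (B.contMDiff_act.comp (contMDiff_const.prodMk contMDiff_id) g).mdifferentiableAt
    (n := ∞) (by simp)

variable (B : PrincipalBundle IM IG IP M G P)

theorem mdifferentiableAt_proj (p : P) : MDifferentiableAt IP IM B.proj p :=
  (B.contMDiff_proj p).mdifferentiableAt (by simp)

/-- The infinitesimal action `u ↦ u_P(p)`, as a linear map between the model spaces. -/
def generatorMap (_B : PrincipalBundle IM IG IP M G P) (p : P) : EG →L[ℝ] EP :=
  modelDeriv IG IP (fun g : G => MulOpposite.op g • p) 1

theorem modelDeriv_proj_generatorMap (p : P) (u : EG) :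
    modelDeriv IP IM B.proj p (B.generatorMap p u) = 0 := by
  have hconst : (fun g : G => B.proj (MulOpposite.op g • p)) = fun _ => B.proj p :=
    funext fun g => B.proj_act p g
  rw [generatorMap, ← modelDeriv_comp_of_eq (B.mdifferentiableAt_proj p)
    (B.mdifferentiableAt_orbit p 1) (one_smul _ p), hconst, modelDeriv_const]

theorem exists_generatorMap_eq [LieGroup IG ∞ G] {p : P} {X : EP}
    (hX : modelDeriv IP IM B.proj p X = 0) : ∃ u : EG, B.generatorMap p u = X := by
  obtain ⟨e, hx, he⟩ := B.exists_trivialization (B.proj p)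
  have hp : p ∈ e.source := e.mem_source.2 hx
  set γ := (e p).2
  set Z : EM × EG := modelDeriv IP (IM.prod IG) e p X
  have hep : e p = (B.proj p, γ) := Prod.ext (e.coe_fst hp) rfl
  have hZ : Z = (0, Z.2) := Prod.ext ((he.fst_modelDeriv hp X).trans hX) rfl
  have hleft : MDifferentiableAt IG IG (fun h : G => γ⁻¹ * h) γ :=
    (contMDiff_mul_left (I := IG) (n := ∞) (a := γ⁻¹) γ).mdifferentiableAt (by simp)
  have hfibre : MDifferentiableAt IG (IM.prod IG) (fun h : G => (B.proj p, h)) γ :=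
    mdifferentiableAt_const.prodMk mdifferentiableAt_id
  have hfibre_apply :
      modelDeriv IG (IM.prod IG) (fun h : G => (B.proj p, h)) γ Z.2 = (0, Z.2) := by
    rw [modelDeriv_prodMk (g := fun h => h) mdifferentiableAt_const mdifferentiableAt_id,
      modelDeriv_const, modelDeriv_id]
  refine ⟨modelDeriv IG IG (fun h : G => γ⁻¹ * h) γ Z.2, ?_⟩
  calc B.generatorMap p (modelDeriv IG IG (fun h : G => γ⁻¹ * h) γ Z.2)
      = modelDeriv IG IP (fun h : G => MulOpposite.op (γ⁻¹ * h) • p) γ Z.2 :=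
        (modelDeriv_comp_of_eq (B.mdifferentiableAt_orbit p 1) hleft
          (inv_mul_cancel γ) Z.2).symm
    _ = modelDeriv IG IP (fun h : G => e.toOpenPartialHomeomorph.symm (B.proj p, h)) γ Z.2 := by
        simp only [he.symm_proj_mk hp, γ]
    _ = modelDeriv (IM.prod IG) IP e.toOpenPartialHomeomorph.symm (e p) Z := by
        exact (modelDeriv_comp_of_eq (he.mdifferentiableAt_symm (e.map_source hp)) hfibre
          hep.symm _).trans (congrArg _ (hfibre_apply.trans hZ.symm))
    _ = X := he.modelDeriv_symm_modelDeriv hp X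

variable {B} in
theorem smoothFieldOn_generatorMap [IsManifold IP ∞ P] [IsManifold IG ∞ G] {u : P → EG}
    {U : Set P} (hu : ContMDiffOn IP 𝓘(ℝ, EG) ∞ u U) :
    SmoothFieldOn IP P (fun p => B.generatorMap p (u p)) U := by
  have hzero : ContMDiffOn IP IP.tangent ∞ (fun p => (⟨p, 0⟩ : TangentBundle IP P)) U :=
    (contMDiff_zeroSection ℝ (TangentSpace IP : P → Type _)).contMDiffOn
  have hact := (B.contMDiff_act.contMDiff_tangentMap (m := ∞) le_rfl).comp_contMDiffOn
    (contMDiff_equivTangentBundleProd_symm.comp_contMDiffOn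
      (hzero.prodMk (contMDiffOn_tangentBundle_mk_const hu (1 : G))))
  refine hact.congr fun p _ => tangentBundle_mk_eq_mk (one_smul _ p).symm ?_
  have hpair : modelDeriv IG (IP.prod IG) (fun g : G => (p, g)) 1 (u p) = (0, u p) := by
    rw [modelDeriv_prodMk (g := fun g => g) mdifferentiableAt_const mdifferentiableAt_id,
      modelDeriv_const, modelDeriv_id]
  exact (modelDeriv_comp ((B.contMDiff_act _).mdifferentiableAt (by simp))
    (mdifferentiableAt_const.prodMk mdifferentiableAt_id) (u p)).trans (congrArg _ hpair)

end PrincipalBundle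

end Generators

section GaugeGroupoid

variable {EM HM EG HG EP HP : Type*}
  [NormedAddCommGroup EM] [NormedSpace ℝ EM] [TopologicalSpace HM]
  [NormedAddCommGroup EG] [NormedSpace ℝ EG] [TopologicalSpace HG]
  [NormedAddCommGroup EP] [NormedSpace ℝ EP] [TopologicalSpace HP]
  {IM : ModelWithCorners ℝ EM HM} {IG : ModelWithCorners ℝ EG HG} {IP : ModelWithCorners ℝ EP HP}
  {M G P : Type*}
  [TopologicalSpace M] [ChartedSpace HM M] [TopologicalSpace P] [ChartedSpace HP P]
  [TopologicalSpace G] [ChartedSpace HG G] [Group G] [MulAction Gᵐᵒᵖ P]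

namespace PrincipalBundle

variable {k : ℕ} (B : PrincipalBundle IM IG IP M G P)

variable [LieGroup IG ∞ G]

instance [T2Space M] [T2Space G] : T2Space B.GaugeSpace := by
  refine ⟨fun c d hcd => ?_⟩
  by_cases htgt : B.gaugeTgt c = B.gaugeTgt d
  swap; · exact separated_by_continuous B.continuous_gaugeTgt htgt
  by_cases hsrc : B.gaugeSrc c = B.gaugeSrc d
  swap; · exact separated_by_continuous B.continuous_gaugeSrc hsrc
  obtain ⟨e, hx, he⟩ := B.exists_trivialization (B.gaugeTgt c)
  obtain ⟨e', hx', he'⟩ := B.exists_trivialization (B.gaugeSrc c)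
  set ψ := gaugeTriv e e' he he'
  have hc : c ∈ ψ.source := ⟨hx, hx'⟩
  have hd : d ∈ ψ.source := ⟨htgt ▸ hx, hsrc ▸ hx'⟩
  obtain ⟨U, V, hU, hV, hcU, hdV, hUV⟩ := t2_separation (ψ.injOn.ne hc hd hcd)
  exact ⟨ψ.source ∩ ψ ⁻¹' U, ψ.source ∩ ψ ⁻¹' V, ψ.isOpen_inter_preimage hU,
    ψ.isOpen_inter_preimage hV, ⟨hc, hcU⟩, ⟨hd, hdV⟩,
    ((hUV.preimage ψ).inter_left' _).inter_right' _⟩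

variable [IsManifold IM ∞ M]

theorem mdifferentiableAt_arrow (z : P × P) :
    MDifferentiableAt (IP.prod IP) (IM.prod (IG.prod IM)) B.arrow z :=
  (B.contMDiff_arrow z).mdifferentiableAt (by simp)

/-- The derivative `(X, Y) ↦ \overline{(X, Y)}` of the quotient map `P × P → (P × P) / G`, as a
linear map between the model spaces. -/
def tangentArrow (z : P × P) : EP × EP →L[ℝ] EM × EG × EM :=
  modelDeriv (IP.prod IP) (IM.prod (IG.prod IM)) B.arrow z

section AlongMaps

variable {E H N : Type*} [NormedAddCommGroup E] [NormedSpace ℝ E] [TopologicalSpace H]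
  {I : ModelWithCorners ℝ E H} [TopologicalSpace N] [ChartedSpace H N] {f g : N → P} {x : N}

theorem mdifferentiableAt_arrow_comp (hf : MDifferentiableAt I IP f x)
    (hg : MDifferentiableAt I IP g x) :
    MDifferentiableAt I (IM.prod (IG.prod IM)) (fun y => B.arrow (f y, g y)) x :=
  (B.mdifferentiableAt_arrow (f x, g x)).comp x (hf.prodMk hg)

theorem modelDeriv_arrow_comp (hf : MDifferentiableAt I IP f x)
    (hg : MDifferentiableAt I IP g x) (v : E) :
    modelDeriv I (IM.prod (IG.prod IM)) (fun y => B.arrow (f y, g y)) x v =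
      B.tangentArrow (f x, g x) (modelDeriv I IP f x v, modelDeriv I IP g x v) := by
  rw [← modelDeriv_prodMk hf hg]
  exact modelDeriv_comp (f := fun y => (f y, g y)) (B.mdifferentiableAt_arrow (f x, g x))
    (hf.prodMk hg) v

end AlongMaps

theorem surjective_tangentArrow (z : P × P) : Surjective (B.tangentArrow z) := by
  intro v
  obtain ⟨σ, hσ, hsection⟩ := B.exists_section (B.arrow z)
  obtain ⟨g, hg⟩ := B.arrow_eq_arrow.1 hsection.self_of_nhds.symm
  let τ (c : B.GaugeSpace) : P × P := (MulOpposite.op g • (σ c).1, MulOpposite.op g • (σ c).2)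
  have hτ : MDifferentiableAt (IM.prod (IG.prod IM)) (IP.prod IP) τ (B.arrow z) :=
    ((((B.contMDiff_act_const g).comp contMDiff_fst).prodMk
      ((B.contMDiff_act_const g).comp contMDiff_snd) _).comp _ hσ).mdifferentiableAt (by simp)
  have hτsection : (fun c => B.arrow (τ c)) =ᶠ[𝓝 (B.arrow z)] fun c => c := by
    filter_upwards [hsection] with c hc using (B.arrow_act g (σ c)).trans hc
  refine ⟨modelDeriv (IM.prod (IG.prod IM)) (IP.prod IP) τ (B.arrow z) v, ?_⟩
  rw [tangentArrow, ← modelDeriv_comp_of_eq (B.mdifferentiableAt_arrow z) hτ hg.symm,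
    modelDeriv_congr hτsection, modelDeriv_id]

theorem tangentArrow_generatorMap (p q : P) (u : EG) :
    B.tangentArrow (p, q) (B.generatorMap p u, B.generatorMap q u) = 0 := by
  have horbit := B.modelDeriv_arrow_comp (B.mdifferentiableAt_orbit p 1)
    (B.mdifferentiableAt_orbit q 1) u
  have hconst : (fun g : G => B.arrow (MulOpposite.op g • p, MulOpposite.op g • q)) =
      fun _ => B.arrow (p, q) := funext fun g => B.arrow_act g (p, q)
  rw [hconst, modelDeriv_const, MulOpposite.op_one, one_smul, one_smul] at horbit
  exact horbit.symm

theorem modelDeriv_gaugeSrc_tangentArrow (p q : P) (Z : EP × EP) :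
    modelDeriv (IM.prod (IG.prod IM)) IM B.gaugeSrc (B.arrow (p, q)) (B.tangentArrow (p, q) Z) =
      modelDeriv IP IM B.proj q Z.2 :=
  (modelDeriv_comp ((B.contMDiff_gaugeSrc _).mdifferentiableAt (by simp))
    (B.mdifferentiableAt_arrow (p, q)) Z).symm.trans
  ((modelDeriv_comp (x := (p, q)) (B.mdifferentiableAt_proj q) mdifferentiableAt_snd Z).trans
    (congrArg _ (modelDeriv_snd _ Z)))

theorem modelDeriv_gaugeTgt_tangentArrow (p q : P) (Z : EP × EP) :
    modelDeriv (IM.prod (IG.prod IM)) IM B.gaugeTgt (B.arrow (p, q)) (B.tangentArrow (p, q) Z) =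
      modelDeriv IP IM B.proj p Z.1 :=
  (modelDeriv_comp ((B.contMDiff_gaugeTgt _).mdifferentiableAt (by simp))
    (B.mdifferentiableAt_arrow (p, q)) Z).symm.trans
  ((modelDeriv_comp (x := (p, q)) (B.mdifferentiableAt_proj p) mdifferentiableAt_fst Z).trans
    (congrArg _ (modelDeriv_fst _ Z)))

theorem mulExt_arrow (p q r : P) :
    B.gaugeGroupoid.mulExt (B.arrow (p, q), B.arrow (q, r)) = B.arrow (p, r) :=
  have hcomposable : B.gaugeGroupoid.src (B.arrow (p, q)) = B.gaugeGroupoid.tgt (B.arrow (q, r)) :=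
    rfl
  (dif_pos hcomposable).trans (B.gaugeMul_arrow p q r)

theorem tangentMul_tangentArrow (p q r : P) (X Y Z : EP) :
    (B.gaugeGroupoid.tangentMul (B.arrow (p, q)) (B.arrow (q, r)) (B.tangentArrow (p, q) (X, Y))
      (B.tangentArrow (q, r) (Y, Z)) : EM × EG × EM) = B.tangentArrow (p, r) (X, Z) := by
  let w : P × P × P := (p, q, r)
  let V : EP × EP × EP := (X, Y, Z)
  have h₁ : MDifferentiableAt (IP.prod (IP.prod IP)) IP (fun w : P × P × P => w.1) w :=
    mdifferentiableAt_fst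
  have h₂ : MDifferentiableAt (IP.prod (IP.prod IP)) IP (fun w : P × P × P => w.2.1) w :=
    mdifferentiableAt_fst.comp w mdifferentiableAt_snd
  have h₃ : MDifferentiableAt (IP.prod (IP.prod IP)) IP (fun w : P × P × P => w.2.2) w :=
    mdifferentiableAt_snd.comp w mdifferentiableAt_snd
  have hX : modelDeriv (IP.prod (IP.prod IP)) IP (fun w : P × P × P => w.1) w V = X :=
    modelDeriv_fst w V
  have hY : modelDeriv (IP.prod (IP.prod IP)) IP (fun w : P × P × P => w.2.1) w V = Y := by
    rw [modelDeriv_comp mdifferentiableAt_fst mdifferentiableAt_snd, modelDeriv_snd, modelDeriv_fst]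
  have hZ : modelDeriv (IP.prod (IP.prod IP)) IP (fun w : P × P × P => w.2.2) w V = Z := by
    rw [modelDeriv_comp mdifferentiableAt_snd mdifferentiableAt_snd, modelDeriv_snd, modelDeriv_snd]
  have hmul := B.gaugeGroupoid.tangentMul_modelDeriv (B.mdifferentiableAt_arrow_comp h₁ h₂)
    (B.mdifferentiableAt_arrow_comp h₂ h₃) (fun _ => rfl) V
  simp only [mulExt_arrow] at hmul
  rw [B.modelDeriv_arrow_comp h₁ h₂, B.modelDeriv_arrow_comp h₂ h₃, B.modelDeriv_arrow_comp h₁ h₃,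
    hX, hY, hZ] at hmul
  exact hmul

theorem modelDeriv_eq_of_tangentComposable {g h : B.GaugeSpace} {v w : EM × EG × EM}
    (hvw : B.gaugeGroupoid.TangentComposable g h v w) :
    modelDeriv (IM.prod (IG.prod IM)) IM B.gaugeSrc g v =
      modelDeriv (IM.prod (IG.prod IM)) IM B.gaugeTgt h w :=
  congrArg (fun v : TangentBundle IM M => (v.2 : EM)) hvw

theorem exists_tangentArrow_eq_of_tangentComposable {p q r : P} {v w : EM × EG × EM}
    (hvw : B.gaugeGroupoid.TangentComposable (B.arrow (p, q)) (B.arrow (q, r)) v w) :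
    ∃ X Y Z : EP, B.tangentArrow (p, q) (X, Y) = v ∧ B.tangentArrow (q, r) (Y, Z) = w := by
  have hproj := B.modelDeriv_eq_of_tangentComposable hvw
  obtain ⟨⟨X, Y⟩, rfl⟩ := B.surjective_tangentArrow (p, q) v
  obtain ⟨⟨Y', Z⟩, rfl⟩ := B.surjective_tangentArrow (q, r) w
  rw [modelDeriv_gaugeSrc_tangentArrow, modelDeriv_gaugeTgt_tangentArrow] at hproj
  obtain ⟨u, hu⟩ := B.exists_generatorMap_eq (p := q) (X := Y - Y') (by
    rw [map_sub, hproj, sub_self])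
  have hYZ : (Y, Z + B.generatorMap r u) = (Y', Z) + (B.generatorMap q u, B.generatorMap r u) := by
    rw [hu, Prod.mk_add_mk, add_sub_cancel]
  exact ⟨X, Y, Z + B.generatorMap r u, rfl, by
    rw [hYZ, map_add, tangentArrow_generatorMap, add_zero]⟩

variable [IsManifold IP ∞ P]

/-- The form `R` on the gauge groupoid is induced by the form `ρ` on the total space:
`R (\overline{(X₁, Y₁)}, …, \overline{(Xₖ, Yₖ)}) = \overline{(ρ (X₁, …, Xₖ), ρ (Y₁, …, Yₖ))}`. -/
def IsInducedBy (R : VectorForm (IM.prod (IG.prod IM)) B.GaugeSpace k) (ρ : VectorForm IP P k) :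
    Prop :=
  ∀ (p q : P) (X Y : Fin k → EP),
    R (B.arrow (p, q)) (fun i => B.tangentArrow (p, q) (X i, Y i)) =
      B.tangentArrow (p, q) (ρ p X, ρ q Y)

namespace IsInducedBy

variable {B}

theorem isMultiplicative {R : VectorForm (IM.prod (IG.prod IM)) B.GaugeSpace k}
    {ρ : VectorForm IP P k} {ρM : VectorForm IM M k} (h : B.IsInducedBy R ρ)
    (hρ : VectorForm.IsRelated B.proj ρ ρM) : B.gaugeGroupoid.IsMultiplicative R := by
  have exists_lift (p q : P) (v : Fin k → EM × EG × EM) : ∃ X Y : Fin k → EP,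
      (fun i => B.tangentArrow (p, q) (X i, Y i)) = v := by
    choose Z hZ using fun i => B.surjective_tangentArrow (p, q) (v i)
    exact ⟨fun i => (Z i).1, fun i => (Z i).2, funext hZ⟩
  refine ⟨ρM, fun g v => ?_, fun g v => ?_, fun g h' v w hgh hvw => ?_⟩
  · obtain ⟨⟨p, q⟩, rfl⟩ := B.arrow_surjective g
    obtain ⟨X, Y, rfl⟩ := exists_lift p q v
    refine (congrArg _ (h p q X Y)).trans ((B.modelDeriv_gaugeSrc_tangentArrow p q _).trans
      ((hρ q Y).trans (congrArg (ρM (B.proj q)) (funext fun i => ?_))))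
    exact (B.modelDeriv_gaugeSrc_tangentArrow p q (X i, Y i)).symm
  · obtain ⟨⟨p, q⟩, rfl⟩ := B.arrow_surjective g
    obtain ⟨X, Y, rfl⟩ := exists_lift p q v
    refine (congrArg _ (h p q X Y)).trans ((B.modelDeriv_gaugeTgt_tangentArrow p q _).trans
      ((hρ p X).trans (congrArg (ρM (B.proj p)) (funext fun i => ?_))))
    exact (B.modelDeriv_gaugeTgt_tangentArrow p q (X i, Y i)).symm
  · obtain ⟨⟨p, q⟩, rfl⟩ := B.arrow_surjective g
    obtain ⟨r, rfl⟩ : ∃ r, h' = B.arrow (q, r) :=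
      B.exists_arrow_eq (g := B.arrow (p, q)) (h := h') hgh (p, q) rfl
    choose X Y Z hXY hYZ using fun i => B.exists_tangentArrow_eq_of_tangentComposable (hvw i)
    obtain rfl : (fun i => B.tangentArrow (p, q) (X i, Y i)) = v := funext hXY
    obtain rfl : (fun i => B.tangentArrow (q, r) (Y i, Z i)) = w := funext hYZ
    have hmul := funext fun i => B.tangentMul_tangentArrow p q r (X i) (Y i) (Z i)
    exact (VectorForm.apply_congr_base R (B.mulExt_arrow p q r) _).trans
      ((congrArg (R (B.arrow (p, r))) hmul).trans
      ((h p r X Z).trans ((B.tangentMul_tangentArrow p q r _ (ρ q Y) _).symm.trans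
      (congrArg₂ (B.gaugeGroupoid.tangentMul (B.arrow (p, q)) (B.arrow (q, r)))
        (h p q X Y).symm (h q r Y Z).symm))))

variable {K : VectorForm (IM.prod (IG.prod IM)) B.GaugeSpace 1} {ρ : VectorForm IP P 1}

theorem endo_tangentArrow (h : B.IsInducedBy K ρ) (p q : P) (X Y : EP) :
    K.endo (B.arrow (p, q)) (B.tangentArrow (p, q) (X, Y)) =
      B.tangentArrow (p, q) (ρ.endo p X, ρ.endo q Y) :=
  h p q (fun _ => X) fun _ => Y

theorem compl_tangentArrow (h : B.IsInducedBy K ρ) (p q : P) (X Y : EP) :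
    K.compl (B.arrow (p, q)) (B.tangentArrow (p, q) (X, Y)) =
      B.tangentArrow (p, q) (ρ.compl p X, ρ.compl q Y) :=
  (congrArg (B.tangentArrow (p, q) (X, Y) - ·) (h.endo_tangentArrow p q X Y)).trans
    (map_sub (B.tangentArrow (p, q)) (X, Y) (ρ.endo p X, ρ.endo q Y)).symm

theorem isProjection (h : B.IsInducedBy K ρ) (hρ : ρ.IsProjection) : K.IsProjection := by
  intro g v
  obtain ⟨⟨p, q⟩, rfl⟩ := B.arrow_surjective g
  obtain ⟨⟨X, Y⟩, rfl⟩ := B.surjective_tangentArrow (p, q) v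
  exact (congrArg (K.endo _) (h.endo_tangentArrow p q X Y)).trans
    ((h.endo_tangentArrow p q _ _).trans
    ((congrArg₂ (fun X Y => B.tangentArrow (p, q) (X, Y)) (hρ p X) (hρ q Y)).trans
    (h.endo_tangentArrow p q X Y).symm))

end IsInducedBy

end PrincipalBundle

end GaugeGroupoid

section HorizontalProduct

variable {E E' H H' N N' : Type*}
  [NormedAddCommGroup E] [NormedSpace ℝ E] [TopologicalSpace H] {I : ModelWithCorners ℝ E H}
  [NormedAddCommGroup E'] [NormedSpace ℝ E'] [TopologicalSpace H'] {I' : ModelWithCorners ℝ E' H'}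
  [TopologicalSpace N] [ChartedSpace H N] [IsManifold I ∞ N]
  [TopologicalSpace N'] [ChartedSpace H' N'] [IsManifold I' ∞ N']

namespace VectorForm

/-- The vector field `(X, X')` on the product, made horizontal for `K` and `K'`. -/
def horizontalProd (K : VectorForm I N 1) (K' : VectorForm I' N' 1)
    (X : ∀ x : N, TangentSpace I x) (X' : ∀ y : N', TangentSpace I' y) (z : N × N') :
    TangentSpace (I.prod I') z :=
  (K.compl z.1 (X z.1), K'.compl z.2 (X' z.2))

variable [FiniteDimensional ℝ E] [FiniteDimensional ℝ E'] {K : VectorForm I N 1}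
  {K' : VectorForm I' N' 1} {z : N × N'} {X Y : ∀ x : N, TangentSpace I x}
  {X' Y' : ∀ y : N', TangentSpace I' y}

theorem mdifferentiableAt_horizontalProd (hX : MDiffAt (T% X) z.1) (hX' : MDiffAt (T% X') z.2) :
    MDiffAt (T% (K.horizontalProd K' X X')) z :=
  mdifferentiableAt_prodField (K.mdifferentiableAt_compl hX) (K'.mdifferentiableAt_compl hX')

variable [I.Boundaryless] [I'.Boundaryless]

theorem endo_fst_mlieBracket_horizontalProd (hK : K.IsProjection)
    (hX : MDiffAt (T% X) z.1) (hX' : MDiffAt (T% X') z.2)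
    (hY : MDiffAt (T% Y) z.1) (hY' : MDiffAt (T% Y') z.2) :
    K.endo z.1 (VectorField.mlieBracket (I.prod I') (K.horizontalProd K' X X')
      (K.horizontalProd K' Y Y') z : E × E').1 = curvatureBilin hK z.1 (X z.1) (Y z.1) := by
  have : CompleteSpace (E × E') := FiniteDimensional.complete ℝ _
  have hfst (W : ∀ x : N, TangentSpace I x) (W' : ∀ y : N', TangentSpace I' y) (w : N × N') :
      modelDeriv (I.prod I') I Prod.fst w (K.horizontalProd K' W W' w) = K.compl w.1 (W w.1) :=
    modelDeriv_fst w _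
  have hzero (W : ∀ x : N, TangentSpace I x) (W' : ∀ y : N', TangentSpace I' y) :
      ∀ᶠ w in 𝓝 z, K.endo w.1
        (modelDeriv (I.prod I') I Prod.fst w (K.horizontalProd K' W W' w)) = 0 :=
    .of_forall fun w => (congrArg (K.endo w.1) (hfst W W' w)).trans (hK.endo_compl _ _)
  exact (congrArg (K.endo z.1) (modelDeriv_fst (E := E) (E' := E') z _)).symm.trans
    ((endo_modelDeriv_mlieBracket hK contMDiffAt_fst (mdifferentiableAt_horizontalProd hX hX')
      (mdifferentiableAt_horizontalProd hY hY') (hzero X X') (hzero Y Y')).trans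
    ((congrArg₂ (fun v w => curvatureBilin hK z.1 v w) (hfst X X' z) (hfst Y Y' z)).trans
      (curvatureBilin_compl hK _ _ _)))

theorem endo_snd_mlieBracket_horizontalProd (hK' : K'.IsProjection)
    (hX : MDiffAt (T% X) z.1) (hX' : MDiffAt (T% X') z.2)
    (hY : MDiffAt (T% Y) z.1) (hY' : MDiffAt (T% Y') z.2) :
    K'.endo z.2 (VectorField.mlieBracket (I.prod I') (K.horizontalProd K' X X')
      (K.horizontalProd K' Y Y') z : E × E').2 = curvatureBilin hK' z.2 (X' z.2) (Y' z.2) := by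
  have : CompleteSpace (E × E') := FiniteDimensional.complete ℝ _
  have hsnd (W : ∀ x : N, TangentSpace I x) (W' : ∀ y : N', TangentSpace I' y) (w : N × N') :
      modelDeriv (I.prod I') I' Prod.snd w (K.horizontalProd K' W W' w) = K'.compl w.2 (W' w.2) :=
    modelDeriv_snd w _
  have hzero (W : ∀ x : N, TangentSpace I x) (W' : ∀ y : N', TangentSpace I' y) :
      ∀ᶠ w in 𝓝 z, K'.endo w.2
        (modelDeriv (I.prod I') I' Prod.snd w (K.horizontalProd K' W W' w)) = 0 :=
    .of_forall fun w => (congrArg (K'.endo w.2) (hsnd W W' w)).trans (hK'.endo_compl _ _)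
  exact (congrArg (K'.endo z.2) (modelDeriv_snd (E := E) (E' := E') z _)).symm.trans
    ((endo_modelDeriv_mlieBracket hK' contMDiffAt_snd (mdifferentiableAt_horizontalProd hX hX')
      (mdifferentiableAt_horizontalProd hY hY') (hzero X X') (hzero Y Y')).trans
    ((congrArg₂ (fun v w => curvatureBilin hK' z.2 v w) (hsnd X X' z) (hsnd Y Y' z)).trans
      (curvatureBilin_compl hK' _ _ _)))

end VectorForm

end HorizontalProduct

section GaugeCurvature

variable {EM HM EG HG EP HP : Type*}
  [NormedAddCommGroup EM] [NormedSpace ℝ EM] [FiniteDimensional ℝ EM] [TopologicalSpace HM]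
  [NormedAddCommGroup EG] [NormedSpace ℝ EG] [FiniteDimensional ℝ EG] [TopologicalSpace HG]
  [NormedAddCommGroup EP] [NormedSpace ℝ EP] [FiniteDimensional ℝ EP] [TopologicalSpace HP]
  {IM : ModelWithCorners ℝ EM HM} [IM.Boundaryless]
  {IG : ModelWithCorners ℝ EG HG} [IG.Boundaryless]
  {IP : ModelWithCorners ℝ EP HP} [IP.Boundaryless]
  {M G P : Type*}
  [TopologicalSpace M] [ChartedSpace HM M] [IsManifold IM ∞ M]
  [TopologicalSpace G] [ChartedSpace HG G] [Group G] [LieGroup IG ∞ G]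
  [TopologicalSpace P] [ChartedSpace HP P] [IsManifold IP ∞ P] [MulAction Gᵐᵒᵖ P]
  {B : PrincipalBundle IM IG IP M G P}
  {K : VectorForm (IM.prod (IG.prod IM)) B.GaugeSpace 1} {ρ : VectorForm IP P 1}

open VectorForm in
theorem PrincipalBundle.IsInducedBy.curvature (h : B.IsInducedBy K ρ) (hK : K.IsProjection)
    (hρ : ρ.IsProjection) :
    B.IsInducedBy (VectorForm.curvature hK) (VectorForm.curvature hρ) := by
  have : CompleteSpace (EP × EP) := FiniteDimensional.complete ℝ _
  intro p q v w
  obtain ⟨X, hX, hXv⟩ := exists_mdifferentiableAt_apply_eq (I := IP) p (v 0)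
  obtain ⟨Y, hY, hYv⟩ := exists_mdifferentiableAt_apply_eq (I := IP) p (v 1)
  obtain ⟨X', hX', hXw⟩ := exists_mdifferentiableAt_apply_eq (I := IP) q (w 0)
  obtain ⟨Y', hY', hYw⟩ := exists_mdifferentiableAt_apply_eq (I := IP) q (w 1)
  let Z : EP × EP := VectorField.mlieBracket (IP.prod IP) (ρ.horizontalProd ρ X X')
    (ρ.horizontalProd ρ Y Y') (p, q)
  have hfst : ρ.endo p Z.1 = curvatureBilin hρ p (v 0) (v 1) := by
    rw [← hXv, ← hYv]
    exact endo_fst_mlieBracket_horizontalProd (z := (p, q)) hρ hX hX' hY hY'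
  have hsnd : ρ.endo q Z.2 = curvatureBilin hρ q (w 0) (w 1) := by
    rw [← hXw, ← hYw]
    exact endo_snd_mlieBracket_horizontalProd (z := (p, q)) hρ hX hX' hY hY'
  have hcompl (U U' : ∀ p : P, TangentSpace IP p) (z : P × P) :
      B.tangentArrow z (ρ.horizontalProd ρ U U' z) =
        K.compl (B.arrow z) (B.tangentArrow z (U z.1, U' z.2)) :=
    (h.compl_tangentArrow z.1 z.2 (U z.1) (U' z.2)).symm
  have hzero (U U' : ∀ p : P, TangentSpace IP p) : ∀ᶠ z in 𝓝 (p, q),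
      K.endo (B.arrow z) (B.tangentArrow z (ρ.horizontalProd ρ U U' z)) = 0 :=
    .of_forall fun z => (congrArg (K.endo (B.arrow z)) (hcompl U U' z)).trans (hK.endo_compl _ _)
  have hbracket : K.endo (B.arrow (p, q)) (B.tangentArrow (p, q) Z) =
      curvatureBilin hK (B.arrow (p, q)) (B.tangentArrow (p, q) (v 0, w 0))
        (B.tangentArrow (p, q) (v 1, w 1)) := by
    rw [← hXv, ← hYv, ← hXw, ← hYw]
    exact (endo_modelDeriv_mlieBracket hK (B.contMDiff_arrow (p, q))
      (mdifferentiableAt_horizontalProd hX hX') (mdifferentiableAt_horizontalProd hY hY')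
      (hzero X X') (hzero Y Y')).trans
      ((congrArg₂ (fun v w => curvatureBilin hK (B.arrow (p, q)) v w) (hcompl X X' (p, q))
        (hcompl Y Y' (p, q))).trans (curvatureBilin_compl hK _ _ _))
  exact hbracket.symm.trans ((h.endo_tangentArrow p q Z.1 Z.2).trans
    (congrArg₂ (fun a b => B.tangentArrow (p, q) (a, b)) hfst hsnd))

end GaugeCurvature

section Connection

variable {EM HM EG HG EP HP : Type*}
  [NormedAddCommGroup EM] [NormedSpace ℝ EM] [TopologicalSpace HM]
  [NormedAddCommGroup EG] [NormedSpace ℝ EG] [TopologicalSpace HG]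
  [NormedAddCommGroup EP] [NormedSpace ℝ EP] [TopologicalSpace HP]
  {IM : ModelWithCorners ℝ EM HM} {IG : ModelWithCorners ℝ EG HG} {IP : ModelWithCorners ℝ EP HP}
  {M G P : Type*}
  [TopologicalSpace M] [ChartedSpace HM M] [TopologicalSpace P] [ChartedSpace HP P]
  [TopologicalSpace G] [ChartedSpace HG G] [Group G] [MulAction Gᵐᵒᵖ P]
  [IsManifold IP ∞ P] {B : PrincipalBundle IM IG IP M G P}

namespace PrincipalBundle.Connection

/-- The vertical projection `Θ(X) = θ(X)_P` of a principal connection. -/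
def vertForm [IsManifold IG ∞ G] (θ : B.Connection) : VectorForm IP P 1 where
  toFun p := ContinuousAlternatingMap.ofSubsingleton ℝ _ _ (0 : Fin 1)
    ((B.generatorMap p).comp (θ.toFun p))
  smooth' U hU X hX := smoothFieldOn_generatorMap (θ.smooth' U hU (X 0) (hX 0))

theorem isProjection_vertForm [IsManifold IG ∞ G] (θ : B.Connection) :
    θ.vertForm.IsProjection :=
  fun p X => congrArg (B.generatorMap p) (θ.map_generator (θ.toFun p X) p)

theorem isRelated_vertForm [IsManifold IG ∞ G] [IsManifold IM ∞ M] (θ : B.Connection) :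
    VectorForm.IsRelated B.proj θ.vertForm (0 : VectorForm IM M 1) :=
  fun p X => B.modelDeriv_proj_generatorMap p (θ.toFun p (X 0))

theorem Induces.isInducedBy [LieGroup IG ∞ G] [IsManifold IM ∞ M] {θ : B.Connection}
    {K : VectorForm (IM.prod (IG.prod IM)) B.GaugeSpace 1} (hK : θ.Induces K) :
    B.IsInducedBy K θ.vertForm := by
  intro p q X Y
  have hconst : (fun i => B.tangentArrow (p, q) (X i, Y i)) =
      fun _ => B.tangentArrow (p, q) (X 0, Y 0) :=
    funext fun i => by rw [Subsingleton.elim i 0]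
  exact (congrArg (K (B.arrow (p, q))) hconst).trans (hK p q (X 0) (Y 0))

end PrincipalBundle.Connection

end Connection
end

theorem mainTheorem5_general
    {EM HM EG HG EP HP : Type*}
    [NormedAddCommGroup EM] [NormedSpace ℝ EM] [FiniteDimensional ℝ EM] [TopologicalSpace HM]
    [NormedAddCommGroup EG] [NormedSpace ℝ EG] [FiniteDimensional ℝ EG] [TopologicalSpace HG]
    [NormedAddCommGroup EP] [NormedSpace ℝ EP] [FiniteDimensional ℝ EP] [TopologicalSpace HP]
    {IM : ModelWithCorners ℝ EM HM} [IM.Boundaryless]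
    {IG : ModelWithCorners ℝ EG HG} [IG.Boundaryless]
    {IP : ModelWithCorners ℝ EP HP} [IP.Boundaryless]
    {M G P : Type*}
    [TopologicalSpace M] [ChartedSpace HM M] [IsManifold IM ∞ M] [T2Space M]
    [TopologicalSpace G] [ChartedSpace HG G] [Group G] [LieGroup IG ∞ G] [T2Space G]
    [TopologicalSpace P] [ChartedSpace HP P] [IsManifold IP ∞ P] [MulAction Gᵐᵒᵖ P]
    (B : PrincipalBundle IM IG IP M G P) {ρ : VectorForm IP P 1} {ρM : VectorForm IM M 1}
    (hρ : ρ.IsProjection) (hρM : VectorForm.IsRelated B.proj ρ ρM)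
    (K : VectorForm (IM.prod (IG.prod IM)) B.GaugeSpace 1) (hK : B.IsInducedBy K ρ) :
    ∃ R : VectorForm (IM.prod (IG.prod IM)) B.GaugeSpace 2,
      IsCurvature K R ∧ (∀ R', IsCurvature K R' → R' = R) ∧ B.gaugeGroupoid.IsMultiplicative R := by
  have hKproj : K.IsProjection := hK.isProjection hρ
  have hcurvature := VectorForm.isCurvature_curvature hKproj
  have hρMproj : ρM.IsProjection :=
    hρM.isProjection B.proj_surjective B.surjective_mfderiv_proj hρ
  have hrelated := hρM.curvature B.contMDiff_proj hρ hρMproj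
  exact ⟨VectorForm.curvature hKproj, hcurvature, fun _ hR' => hR'.unique hcurvature,
    (hK.curvature hKproj hρ).isMultiplicative hrelated⟩

theorem mainTheorem5
    {EM HM EG HG EP HP : Type*}
    [NormedAddCommGroup EM] [NormedSpace ℝ EM] [FiniteDimensional ℝ EM] [TopologicalSpace HM]
    [NormedAddCommGroup EG] [NormedSpace ℝ EG] [FiniteDimensional ℝ EG] [TopologicalSpace HG]
    [NormedAddCommGroup EP] [NormedSpace ℝ EP] [FiniteDimensional ℝ EP] [TopologicalSpace HP]
    {IM : ModelWithCorners ℝ EM HM} [IM.Boundaryless]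
    {IG : ModelWithCorners ℝ EG HG} [IG.Boundaryless]
    {IP : ModelWithCorners ℝ EP HP} [IP.Boundaryless]
    {M G P : Type*}
    [TopologicalSpace M] [ChartedSpace HM M] [IsManifold IM ∞ M] [T2Space M]
    [TopologicalSpace G] [ChartedSpace HG G] [Group G] [LieGroup IG ∞ G] [T2Space G]
    [TopologicalSpace P] [ChartedSpace HP P] [IsManifold IP ∞ P] [T2Space P]
    [MulAction Gᵐᵒᵖ P]
    (B : PrincipalBundle IM IG IP M G P) (θ : B.Connection)
    (K : VectorForm (IM.prod (IG.prod IM)) B.GaugeSpace 1) (hK : θ.Induces K) :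
    ∃ R : VectorForm (IM.prod (IG.prod IM)) B.GaugeSpace 2,
      IsCurvature K R ∧ (∀ R', IsCurvature K R' → R' = R) ∧ B.gaugeGroupoid.IsMultiplicative R :=
  mainTheorem5_general B θ.isProjection_vertForm θ.isRelated_vertForm K hK.isInducedBy
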